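/- Let $\mathsf{At}$ be a set. Formulae are generated by $A,B ::= X \mid \mathsf I \mid A\otimes B \mid A\wedge B \mid A\vee B$ with $X\in\mathsf{At}$. A sequent $S\mid\Gamma\vdash A$ consists of an optional formula $S$ (written $-$ when absent), a list of formulae $\Gamma$ and a formula $A$. Derivations are generated by the following rules (premises to the left of $\Rightarrow$): - $\mathsf{ax}_A$: $A\mid\ \vdash A$; $\quad\mathsf{pass}$: $A\mid\Gamma\vdash C\ \Rightarrow\ -\mid A,\Gamma\vdash C$; $\quad\mathsf{IL}$: $-\mid\Gamma\vdash C\ \Rightarrow\ \mathsf I\mid\Gamma\vdash C$; $\quad\mathsf{IR}$: $-\mid\ \vdash\mathsf I$; - $\otimes\mathsf L$: $A\mid B,\Gamma\vdash C\ \Rightarrow\ A\otimes B\mid\Gamma\vdash C$; $\quad\otimes\mathsf R$: $S\mid\Gamma\vdash A$ and $-\mid\Delta\vdash B\ \Rightarrow\ S\mid\Gamma,\Delta\vdash A\otimes B$; - $\wedge\mathsf L_1$: $A\mid\Gamma\vdash C\ \Rightarrow\ A\wedge B\mid\Gamma\vdash C$; $\quad\wedge\mathsf L_2$: $B\mid\Gamma\vdash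 C\ \Rightarrow\ A\wedge B\mid\Gamma\vdash C$; $\quad\wedge\mathsf R$: $S\mid\Gamma\vdash A$ and $S\mid\Gamma\vdash B\ \Rightarrow\ S\mid\Gamma\vdash A\wedge B$; - $\vee\mathsf L$: $A\mid\Gamma\vdash C$ and $B\mid\Gamma\vdash C\ \Rightarrow\ A\vee B\mid\Gamma\vdash C$; $\quad\vee\mathsf R_1$: $S\mid\Gamma\vdash A\ \Rightarrow\ S\mid\Gamma\vdash A\vee B$; $\quad\vee\mathsf R_2$: $S\mid\Gamma\vdash B\ \Rightarrow\ S\mid\Gamma\vdash A\vee B$. Let $\circeq$ be the least congruence on derivations such that, for all $i,j\in\{1,2\}$ and all derivations for which both sides make sense, $$\begin{aligned} &\mathsf{ax}_{\mathsf I}\circeq\mathsf{IL}(\mathsf{IR}), &&\mathsf{ax}_{A\otimes B}\circeq\otimes\mathsf L(\otimes\mathsf R(\mathsf{ax}_A,\mathsf{pass}\,\mathsf{ax}_B)),\\ &\mathsf{ax}_{A\wedge B}\circeq\wedge\mathsf R(\wedge\mathsf L_1\,\mathsf{ax}_A,\wedge\mathsf L_2\,\mathsf{ax}_B), &&\mathsf{ax}_{A\vee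 B}\circeq\vee\mathsf L(\vee\mathsf R_1\,\mathsf{ax}_A,\vee\mathsf R_2\,\mathsf{ax}_B),\\ &\otimes\mathsf R(\ell f,g)\circeq\ell(\otimes\mathsf R(f,g)), &&\otimes\mathsf R(\vee\mathsf L(f_1,f_2),g)\circeq\vee\mathsf L(\otimes\mathsf R(f_1,g),\otimes\mathsf R(f_2,g)),\\ &\ell(\wedge\mathsf R(f,g))\circeq\wedge\mathsf R(\ell f,\ell g), &&\vee\mathsf L(\wedge\mathsf R(f_1,g_1),\wedge\mathsf R(f_2,g_2))\circeq\wedge\mathsf R(\vee\mathsf L(f_1,f_2),\vee\mathsf L(g_1,g_2)),\\ &\vee\mathsf R_i(\ell f)\circeq\ell(\vee\mathsf R_i f), &&\vee\mathsf R_i(\vee\mathsf L(f,g))\circeq\vee\mathsf L(\vee\mathsf R_i f,\vee\mathsf R_i g), \end{aligned}$$ where $\ell$ ranges over $\mathsf{pass},\mathsf{IL},\otimes\mathsf L,\wedge\mathsf L_j$. Let $\mathsf{scut}$, sending derivations of $S\mid\Gamma\vdash A$ and $A\mid\Delta\vdash C$ to a derivation of $S\mid\Gamma,\Delta\vdash C$,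 be the cut operation defined by the usual cut-elimination recursion (simultaneously with a cut rule for formulae in the context). A skew monoidal category is a category with an object $\mathsf I$, a functor $\otimes$ of two variables and natural transformations (not necessarily invertible) $\lambda_A:\mathsf I\otimes A\to A$, $\rho_A:A\to A\otimes\mathsf I$, $\alpha_{A,B,C}:(A\otimes B)\otimes C\to A\otimes(B\otimes C)$ satisfying $\lambda_{\mathsf I}\circ\rho_{\mathsf I}=\mathrm{id}$, $(A\otimes\lambda_B)\circ\alpha_{A,\mathsf I,B}\circ(\rho_A\otimes B)=\mathrm{id}$, $\lambda_{A\otimes B}\circ\alpha_{\mathsf I,A,B}=\lambda_A\otimes B$, $\alpha_{A,B,\mathsf I}\circ\rho_{A\otimes B}=A\otimes\rho_B$, and $(A\otimes\alpha_{B,C,D})\circ\alpha_{A,B\otimes C,D}\circ(\alpha_{A,B,C}\otimes D)=\alpha_{A,B,C\otimes D}\circ\alpha_{A\otimes B,C,D}$. A distributive skew monoidal category is a skew monoidal category with chosen binary products and chosen binary coproducts such that every canonical morphism $(A\otimes C)+(B\otimes C)\to(A+B)\otimes C$ is invertible. A strict distributive skew monoidal functor is a functor preserving $\mathsf I$, $\otimes$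 (on objects and maps), $\lambda$, $\rho$, $\alpha$ and the chosen products and coproducts with their projections and injections, all on the nose. **Theorem.** (1) The following data form a category $\mathsf{FDSkM}(\mathsf{At})$: objects are formulae; maps $A\to B$ are derivations of $A\mid\ \vdash B$ modulo $\circeq$; the identity on $A$ is the class of $\mathsf{ax}_A$; composition is given by $\mathsf{scut}$ (which is well defined modulo $\circeq$). (2) $\mathsf{FDSkM}(\mathsf{At})$ is a distributive skew monoidal category, where the unit and tensor of objects are the connectives $\mathsf I$ and $\otimes$; $f\otimes g$ is the class of $\otimes\mathsf L(\otimes\mathsf R(f,\mathsf{pass}\,g))$; $\lambda_A$, $\rho_A$, $\alpha_{A,B,C}$ are the classes of $\otimes\mathsf L(\mathsf{IL}(\mathsf{pass}\,\mathsf{ax}_A))$, $\otimes\mathsf R(\mathsf{ax}_A,\mathsf{IR})$ and $\otimes\mathsf L(\otimes\mathsf L(\otimes\mathsf R(\mathsf{ax}_A,\mathsf{pass}(\otimes\mathsf R(\mathsf{ax}_B,\mathsf{pass}\,\mathsf{ax}_C)))))$; products are given by $\wedge$ with projections $\wedge\mathsf L_1\,\mathsf{ax}_A$, $\wedge\mathsf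 L_2\,\mathsf{ax}_B$, and coproducts by $\vee$ with injections $\vee\mathsf R_1\,\mathsf{ax}_A$, $\vee\mathsf R_2\,\mathsf{ax}_B$. (3) For every distributive skew monoidal category $\mathbb D$ and every function $F_{\mathsf{At}}:\mathsf{At}\to|\mathbb D|$ there is a unique strict distributive skew monoidal functor $F:\mathsf{FDSkM}(\mathsf{At})\to\mathbb D$ with $FX=F_{\mathsf{At}}X$ for every atom $X$. -/

import Mathlib

open CategoryTheory CategoryTheory.Limits

universe u v w

namespace SkewLogic

/-! ## The sequent calculus -/

/-- Formulae over a set `At` of atoms. -/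
inductive Fma (At : Type u) : Type u
  | atom (X : At) : Fma At
  | unit : Fma At
  | tensor (A B : Fma At) : Fma At
  | conj (A B : Fma At) : Fma At
  | disj (A B : Fma At) : Fma At

variable {At : Type u}

/-- `Deriv S Γ A` is the set of cut-free derivations of the sequent `S ∣ Γ ⊢ A`; the stoup `S` is
an optional formula, `none` being the empty stoup. -/
inductive Deriv : Option (Fma At) → List (Fma At) → Fma At → Type u
  | ax (A : Fma At) : Deriv (some A) [] A
  | pass {A : Fma At} {Γ : List (Fma At)} {C : Fma At} :
      Deriv (some A) Γ C → Deriv none (A :: Γ) C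
  | unitL {Γ : List (Fma At)} {C : Fma At} : Deriv none Γ C → Deriv (some .unit) Γ C
  | unitR : Deriv none [] .unit
  | tensorL {A B : Fma At} {Γ : List (Fma At)} {C : Fma At} :
      Deriv (some A) (B :: Γ) C → Deriv (some (.tensor A B)) Γ C
  | tensorR {S : Option (Fma At)} {Γ Δ : List (Fma At)} {A B : Fma At} :
      Deriv S Γ A → Deriv none Δ B → Deriv S (Γ ++ Δ) (.tensor A B)
  | conjL₁ {A B : Fma At} {Γ : List (Fma At)} {C : Fma At} :
      Deriv (some A) Γ C → Deriv (some (.conj A B)) Γ C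
  | conjL₂ {A B : Fma At} {Γ : List (Fma At)} {C : Fma At} :
      Deriv (some B) Γ C → Deriv (some (.conj A B)) Γ C
  | conjR {S : Option (Fma At)} {Γ : List (Fma At)} {A B : Fma At} :
      Deriv S Γ A → Deriv S Γ B → Deriv S Γ (.conj A B)
  | disjL {A B : Fma At} {Γ : List (Fma At)} {C : Fma At} :
      Deriv (some A) Γ C → Deriv (some B) Γ C → Deriv (some (.disj A B)) Γ C
  | disjR₁ {S : Option (Fma At)} {Γ : List (Fma At)} {A B : Fma At} :
      Deriv S Γ A → Deriv S Γ (.disj A B)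
  | disjR₂ {S : Option (Fma At)} {Γ : List (Fma At)} {A B : Fma At} :
      Deriv S Γ B → Deriv S Γ (.disj A B)

namespace Deriv

/-- The congruence `≗` on derivations: the least congruence containing the `η`-conversions and the
permutative conversions. -/
inductive Eqv : {S : Option (Fma At)} → {Γ : List (Fma At)} → {A : Fma At} →
    Deriv S Γ A → Deriv S Γ A → Prop
  -- equivalence relation
  | refl {S : Option (Fma At)} {Γ : List (Fma At)} {A : Fma At} (f : Deriv S Γ A) : Eqv f f
  | symm {S : Option (Fma At)} {Γ : List (Fma At)} {A : Fma At} {f g : Deriv S Γ A} :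
      Eqv f g → Eqv g f
  | trans {S : Option (Fma At)} {Γ : List (Fma At)} {A : Fma At} {f g h : Deriv S Γ A} :
      Eqv f g → Eqv g h → Eqv f h
  -- compatibility with the rules
  | pass {A : Fma At} {Γ : List (Fma At)} {C : Fma At} {f f' : Deriv (some A) Γ C} :
      Eqv f f' → Eqv f.pass f'.pass
  | unitL {Γ : List (Fma At)} {C : Fma At} {f f' : Deriv none Γ C} :
      Eqv f f' → Eqv f.unitL f'.unitL
  | tensorL {A B : Fma At} {Γ : List (Fma At)} {C : Fma At} {f f' : Deriv (some A) (B :: Γ) C} :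
      Eqv f f' → Eqv f.tensorL f'.tensorL
  | tensorR {S : Option (Fma At)} {Γ Δ : List (Fma At)} {A B : Fma At}
      {f f' : Deriv S Γ A} {g g' : Deriv none Δ B} :
      Eqv f f' → Eqv g g' → Eqv (f.tensorR g) (f'.tensorR g')
  | conjL₁ {A B : Fma At} {Γ : List (Fma At)} {C : Fma At} {f f' : Deriv (some A) Γ C} :
      Eqv f f' → Eqv (f.conjL₁ (B := B)) f'.conjL₁
  | conjL₂ {A B : Fma At} {Γ : List (Fma At)} {C : Fma At} {f f' : Deriv (some B) Γ C} :
      Eqv f f' → Eqv (f.conjL₂ (A := A)) f'.conjL₂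
  | conjR {S : Option (Fma At)} {Γ : List (Fma At)} {A B : Fma At}
      {f f' : Deriv S Γ A} {g g' : Deriv S Γ B} :
      Eqv f f' → Eqv g g' → Eqv (f.conjR g) (f'.conjR g')
  | disjL {A B : Fma At} {Γ : List (Fma At)} {C : Fma At}
      {f f' : Deriv (some A) Γ C} {g g' : Deriv (some B) Γ C} :
      Eqv f f' → Eqv g g' → Eqv (f.disjL g) (f'.disjL g')
  | disjR₁ {S : Option (Fma At)} {Γ : List (Fma At)} {A B : Fma At} {f f' : Deriv S Γ A} :
      Eqv f f' → Eqv (f.disjR₁ (B := B)) f'.disjR₁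
  | disjR₂ {S : Option (Fma At)} {Γ : List (Fma At)} {A B : Fma At} {f f' : Deriv S Γ B} :
      Eqv f f' → Eqv (f.disjR₂ (A := A)) f'.disjR₂
  -- `η`-conversions
  | ax_unit : Eqv (ax (At := At) .unit) (unitL unitR)
  | ax_tensor (A B : Fma At) :
      Eqv (ax (.tensor A B)) (tensorL (tensorR (ax A) (pass (ax B))))
  | ax_conj (A B : Fma At) : Eqv (ax (.conj A B)) (conjR (conjL₁ (ax A)) (conjL₂ (ax B)))
  | ax_disj (A B : Fma At) : Eqv (ax (.disj A B)) (disjL (disjR₁ (ax A)) (disjR₂ (ax B)))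
  -- permutations of left rules with `tensorR`
  | tensorR_pass {A' A B : Fma At} {Γ Δ : List (Fma At)}
      (f : Deriv (some A') Γ A) (g : Deriv none Δ B) :
      Eqv (tensorR (pass f) g) (pass (tensorR f g))
  | tensorR_unitL {A B : Fma At} {Γ Δ : List (Fma At)}
      (f : Deriv none Γ A) (g : Deriv none Δ B) :
      Eqv (tensorR (unitL f) g) (unitL (tensorR f g))
  | tensorR_tensorL {A' B' A B : Fma At} {Γ Δ : List (Fma At)}
      (f : Deriv (some A') (B' :: Γ) A) (g : Deriv none Δ B) :
      Eqv (tensorR (tensorL f) g) (tensorL (tensorR f g))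
  | tensorR_conjL₁ {A' B' A B : Fma At} {Γ Δ : List (Fma At)}
      (f : Deriv (some A') Γ A) (g : Deriv none Δ B) :
      Eqv (tensorR (conjL₁ (B := B') f) g) (conjL₁ (tensorR f g))
  | tensorR_conjL₂ {A' B' A B : Fma At} {Γ Δ : List (Fma At)}
      (f : Deriv (some B') Γ A) (g : Deriv none Δ B) :
      Eqv (tensorR (conjL₂ (A := A') f) g) (conjL₂ (tensorR f g))
  | tensorR_disjL {A' B' A B : Fma At} {Γ Δ : List (Fma At)}
      (f₁ : Deriv (some A') Γ A) (f₂ : Deriv (some B') Γ A) (g : Deriv none Δ B) :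
      Eqv (tensorR (disjL f₁ f₂) g) (disjL (tensorR f₁ g) (tensorR f₂ g))
  -- permutations of left rules with `conjR`
  | pass_conjR {A' A B : Fma At} {Γ : List (Fma At)}
      (f : Deriv (some A') Γ A) (g : Deriv (some A') Γ B) :
      Eqv (pass (conjR f g)) (conjR (pass f) (pass g))
  | unitL_conjR {A B : Fma At} {Γ : List (Fma At)}
      (f : Deriv none Γ A) (g : Deriv none Γ B) :
      Eqv (unitL (conjR f g)) (conjR (unitL f) (unitL g))
  | tensorL_conjR {A' B' A B : Fma At} {Γ : List (Fma At)}
      (f : Deriv (some A') (B' :: Γ) A) (g : Deriv (some A') (B' :: Γ) B) :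
      Eqv (tensorL (conjR f g)) (conjR (tensorL f) (tensorL g))
  | conjL₁_conjR {A' B' A B : Fma At} {Γ : List (Fma At)}
      (f : Deriv (some A') Γ A) (g : Deriv (some A') Γ B) :
      Eqv (conjL₁ (B := B') (conjR f g)) (conjR (conjL₁ f) (conjL₁ g))
  | conjL₂_conjR {A' B' A B : Fma At} {Γ : List (Fma At)}
      (f : Deriv (some B') Γ A) (g : Deriv (some B') Γ B) :
      Eqv (conjL₂ (A := A') (conjR f g)) (conjR (conjL₂ f) (conjL₂ g))
  | disjL_conjR {A' B' A B : Fma At} {Γ : List (Fma At)}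
      (f₁ : Deriv (some A') Γ A) (f₂ : Deriv (some B') Γ A)
      (g₁ : Deriv (some A') Γ B) (g₂ : Deriv (some B') Γ B) :
      Eqv (disjL (conjR f₁ g₁) (conjR f₂ g₂)) (conjR (disjL f₁ f₂) (disjL g₁ g₂))
  -- permutations of left rules with `disjR₁`
  | disjR₁_pass {A' A B : Fma At} {Γ : List (Fma At)} (f : Deriv (some A') Γ A) :
      Eqv (disjR₁ (B := B) (pass f)) (pass (disjR₁ f))
  | disjR₁_unitL {A B : Fma At} {Γ : List (Fma At)} (f : Deriv none Γ A) :
      Eqv (disjR₁ (B := B) (unitL f)) (unitL (disjR₁ f))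
  | disjR₁_tensorL {A' B' A B : Fma At} {Γ : List (Fma At)} (f : Deriv (some A') (B' :: Γ) A) :
      Eqv (disjR₁ (B := B) (tensorL f)) (tensorL (disjR₁ f))
  | disjR₁_conjL₁ {A' B' A B : Fma At} {Γ : List (Fma At)} (f : Deriv (some A') Γ A) :
      Eqv (disjR₁ (B := B) (conjL₁ (B := B') f)) (conjL₁ (disjR₁ f))
  | disjR₁_conjL₂ {A' B' A B : Fma At} {Γ : List (Fma At)} (f : Deriv (some B') Γ A) :
      Eqv (disjR₁ (B := B) (conjL₂ (A := A') f)) (conjL₂ (disjR₁ f))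
  | disjR₁_disjL {A' B' A B : Fma At} {Γ : List (Fma At)}
      (f : Deriv (some A') Γ A) (g : Deriv (some B') Γ A) :
      Eqv (disjR₁ (B := B) (disjL f g)) (disjL (disjR₁ f) (disjR₁ g))
  -- permutations of left rules with `disjR₂`
  | disjR₂_pass {A' A B : Fma At} {Γ : List (Fma At)} (f : Deriv (some A') Γ B) :
      Eqv (disjR₂ (A := A) (pass f)) (pass (disjR₂ f))
  | disjR₂_unitL {A B : Fma At} {Γ : List (Fma At)} (f : Deriv none Γ B) :
      Eqv (disjR₂ (A := A) (unitL f)) (unitL (disjR₂ f))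
  | disjR₂_tensorL {A' B' A B : Fma At} {Γ : List (Fma At)} (f : Deriv (some A') (B' :: Γ) B) :
      Eqv (disjR₂ (A := A) (tensorL f)) (tensorL (disjR₂ f))
  | disjR₂_conjL₁ {A' B' A B : Fma At} {Γ : List (Fma At)} (f : Deriv (some A') Γ B) :
      Eqv (disjR₂ (A := A) (conjL₁ (B := B') f)) (conjL₁ (disjR₂ f))
  | disjR₂_conjL₂ {A' B' A B : Fma At} {Γ : List (Fma At)} (f : Deriv (some B') Γ B) :
      Eqv (disjR₂ (A := A) (conjL₂ (A := A') f)) (conjL₂ (disjR₂ f))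
  | disjR₂_disjL {A' B' A B : Fma At} {Γ : List (Fma At)}
      (f : Deriv (some A') Γ B) (g : Deriv (some B') Γ B) :
      Eqv (disjR₂ (A := A) (disjL f g)) (disjL (disjR₂ f) (disjR₂ g))

/-- Derivations of a sequent up to `≗`. -/
def setoid (S : Option (Fma At)) (Γ : List (Fma At)) (A : Fma At) : Setoid (Deriv S Γ A) where
  r := Eqv
  iseqv := ⟨Eqv.refl, Eqv.symm, Eqv.trans⟩

/-! ## Cut admissibility -/

/-- Transport of a derivation along an equality of contexts. -/
def castCtx {S : Option (Fma At)} {Γ Γ' : List (Fma At)} {A : Fma At} (h : Γ = Γ')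
    (f : Deriv S Γ A) : Deriv S Γ' A :=
  h ▸ f

/-- Transport of a derivation along an equality of stoup formulae. -/
def castStp {B B' : Fma At} {Γ : List (Fma At)} {A : Fma At} (h : B = B')
    (f : Deriv (some B) Γ A) : Deriv (some B') Γ A :=
  h ▸ f

/-- The number of inferences of a derivation. -/
def size : {S : Option (Fma At)} → {Γ : List (Fma At)} → {A : Fma At} → Deriv S Γ A → ℕ
  | _, _, _, ax _ => 1
  | _, _, _, pass f => f.size + 1
  | _, _, _, unitL f => f.size + 1
  | _, _, _, unitR => 1
  | _, _, _, tensorL f => f.size + 1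
  | _, _, _, tensorR f g => f.size + g.size + 1
  | _, _, _, conjL₁ f => f.size + 1
  | _, _, _, conjL₂ f => f.size + 1
  | _, _, _, conjR f g => f.size + g.size + 1
  | _, _, _, disjL f g => f.size + g.size + 1
  | _, _, _, disjR₁ f => f.size + 1
  | _, _, _, disjR₂ f => f.size + 1

theorem size_castCtx {S : Option (Fma At)} {Γ Γ' : List (Fma At)} {A : Fma At} (h : Γ = Γ')
    (f : Deriv S Γ A) : (castCtx h f).size = f.size := by
  subst h; rfl

theorem size_castStp {B B' : Fma At} {Γ : List (Fma At)} {A : Fma At} (h : B = B')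
    (f : Deriv (some B) Γ A) : (castStp h f).size = f.size := by
  subst h; rfl

/-- If `Γ₁, Γ₂ = Δ₀, A, Δ₁` then the displayed occurrence of `A` lies in `Γ₁` or in `Γ₂`. -/
inductive Split {α : Type u} (Γ₁ Γ₂ Δ₀ : List α) (A : α) (Δ₁ : List α) : Type u
  | left (Λ : List α) (h₁ : Γ₁ = Δ₀ ++ A :: Λ) (h₂ : Δ₁ = Λ ++ Γ₂) : Split Γ₁ Γ₂ Δ₀ A Δ₁
  | right (Λ : List α) (h₁ : Δ₀ = Γ₁ ++ Λ) (h₂ : Γ₂ = Λ ++ A :: Δ₁) : Split Γ₁ Γ₂ Δ₀ A Δ₁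

/-- The side on which the displayed occurrence lies. -/
def split {α : Type u} {Γ₂ : List α} {A : α} {Δ₁ : List α} :
    (Γ₁ Δ₀ : List α) → Γ₁ ++ Γ₂ = Δ₀ ++ A :: Δ₁ → Split Γ₁ Γ₂ Δ₀ A Δ₁
  | [], Δ₀, h => .right Δ₀ rfl h
  | _ :: Γ₁, [], h =>
      .left Γ₁ (by simp only [List.cons_append, List.nil_append, List.cons.injEq] at h ⊢
                   exact ⟨h.1, trivial⟩)
        (by simp only [List.cons_append, List.nil_append, List.cons.injEq] at h; exact h.2.symm)
  | _ :: Γ₁, _ :: Δ₀, h =>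
      have h' := List.cons.inj h
      match split Γ₁ Δ₀ h'.2 with
      | .left Λ h₁ h₂ => .left Λ (by rw [h'.1, h₁]; rfl) h₂
      | .right Λ h₁ h₂ => .right Λ (by rw [h'.1, h₁]; rfl) h₂

mutual

/-- Admissibility of the stoup cut rule. -/
def scut {S : Option (Fma At)} {Γ : List (Fma At)} {A : Fma At} {Δ : List (Fma At)} {C : Fma At}
    (f : Deriv S Γ A) (g : Deriv (some A) Δ C) : Deriv S (Γ ++ Δ) C :=
  match f, g with
  | ax _, g => g
  | pass f, g => pass (scut f g)
  | unitL f, g => unitL (scut f g)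
  | tensorL f, g => tensorL (scut f g)
  | conjL₁ f, g => conjL₁ (scut f g)
  | conjL₂ f, g => conjL₂ (scut f g)
  | disjL f₁ f₂, g => disjL (scut f₁ g) (scut f₂ g)
  | unitR, ax _ => unitR
  | unitR, unitL g => g
  | unitR, tensorR g₁ g₂ => (tensorR (scut unitR g₁ :) g₂ :)
  | unitR, conjR g₁ g₂ => conjR (scut unitR g₁ :) (scut unitR g₂ :)
  | unitR, disjR₁ g => disjR₁ (scut unitR g :)
  | unitR, disjR₂ g => disjR₂ (scut unitR g :)
  | tensorR f₁ f₂, ax _ => castCtx (by simp) (tensorR f₁ f₂)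
  | tensorR f₁ f₂, tensorL g => castCtx (by simp) (scut f₁ (ccut [] f₂ g rfl))
  | tensorR f₁ f₂, tensorR g₁ g₂ => castCtx (by simp) (tensorR (scut (tensorR f₁ f₂) g₁) g₂)
  | tensorR f₁ f₂, conjR g₁ g₂ => conjR (scut (tensorR f₁ f₂) g₁) (scut (tensorR f₁ f₂) g₂)
  | tensorR f₁ f₂, disjR₁ g => disjR₁ (scut (tensorR f₁ f₂) g)
  | tensorR f₁ f₂, disjR₂ g => disjR₂ (scut (tensorR f₁ f₂) g)
  | conjR f₁ f₂, ax _ => castCtx (by simp) (conjR f₁ f₂)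
  | conjR f₁ _, conjL₁ g => scut f₁ g
  | conjR _ f₂, conjL₂ g => scut f₂ g
  | conjR f₁ f₂, tensorR g₁ g₂ => castCtx (by simp) (tensorR (scut (conjR f₁ f₂) g₁) g₂)
  | conjR f₁ f₂, conjR g₁ g₂ => conjR (scut (conjR f₁ f₂) g₁) (scut (conjR f₁ f₂) g₂)
  | conjR f₁ f₂, disjR₁ g => disjR₁ (scut (conjR f₁ f₂) g)
  | conjR f₁ f₂, disjR₂ g => disjR₂ (scut (conjR f₁ f₂) g)
  | disjR₁ f, ax _ => castCtx (by simp) (disjR₁ f)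
  | disjR₁ f, disjL g₁ _ => scut f g₁
  | disjR₁ f, tensorR g₁ g₂ => castCtx (by simp) (tensorR (scut (disjR₁ f) g₁) g₂)
  | disjR₁ f, conjR g₁ g₂ => conjR (scut (disjR₁ f) g₁) (scut (disjR₁ f) g₂)
  | disjR₁ f, disjR₁ g => disjR₁ (scut (disjR₁ f) g)
  | disjR₁ f, disjR₂ g => disjR₂ (scut (disjR₁ f) g)
  | disjR₂ f, ax _ => castCtx (by simp) (disjR₂ f)
  | disjR₂ f, disjL _ g₂ => scut f g₂
  | disjR₂ f, tensorR g₁ g₂ => castCtx (by simp) (tensorR (scut (disjR₂ f) g₁) g₂)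
  | disjR₂ f, conjR g₁ g₂ => conjR (scut (disjR₂ f) g₁) (scut (disjR₂ f) g₂)
  | disjR₂ f, disjR₁ g => disjR₁ (scut (disjR₂ f) g)
  | disjR₂ f, disjR₂ g => disjR₂ (scut (disjR₂ f) g)
termination_by (sizeOf A, f.size + g.size)
decreasing_by all_goals simp [Prod.lex_def, size] <;> omega

/-- Admissibility of the context cut rule. -/
def ccut {S : Option (Fma At)} {Γ : List (Fma At)} {A : Fma At} {Δ : List (Fma At)} {C : Fma At}
    (Δ₀ : List (Fma At)) {Δ₁ : List (Fma At)} (f : Deriv none Γ A) (g : Deriv S Δ C)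
    (h : Δ = Δ₀ ++ A :: Δ₁) : Deriv S (Δ₀ ++ (Γ ++ Δ₁)) C :=
  match g with
  | ax _ => absurd h (by simp)
  | unitR => absurd h (by simp)
  | pass (A := A') (Γ := Γ') g =>
      match Δ₀, h with
      | [], h => (scut f (castCtx (List.cons.inj h).2 (castStp (List.cons.inj h).1 g)) :)
      | _ :: Δ₀, h =>
          castCtx (by rw [(List.cons.inj h).1]; rfl) (pass (ccut Δ₀ f g (List.cons.inj h).2))
  | unitL g => unitL (ccut Δ₀ f g h)
  | tensorL (B := B) g => tensorL (ccut (B :: Δ₀) f g (by rw [h]; rfl))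
  | tensorR (Γ := Γ₁) g₁ g₂ =>
      match split Γ₁ Δ₀ h with
      | .left _ h₁ h₂ => castCtx (by simp [h₂]) (tensorR (ccut Δ₀ f g₁ h₁) g₂)
      | .right Λ h₁ h₂ => castCtx (by simp [h₁]) (tensorR g₁ (ccut Λ f g₂ h₂))
  | conjL₁ g => conjL₁ (ccut Δ₀ f g h)
  | conjL₂ g => conjL₂ (ccut Δ₀ f g h)
  | conjR g₁ g₂ => conjR (ccut Δ₀ f g₁ h) (ccut Δ₀ f g₂ h)
  | disjL g₁ g₂ => disjL (ccut Δ₀ f g₁ h) (ccut Δ₀ f g₂ h)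
  | disjR₁ g => disjR₁ (ccut Δ₀ f g h)
  | disjR₂ g => disjR₂ (ccut Δ₀ f g h)
termination_by (sizeOf A, f.size + g.size)
decreasing_by all_goals simp [Prod.lex_def, size, size_castCtx, size_castStp]

end

end Deriv

/-! ## Distributive skew monoidal categories -/

/-- The data of a distributive skew monoidal category: a skew monoidal structure together with
chosen binary products and coproducts. -/
class DistSkewMonoidalStruct (C : Type u) [Category.{v} C] where
  unit : C
  tensorObj : C → C → C
  tensorHom {A A' B B' : C} (f : A ⟶ A') (g : B ⟶ B') : tensorObj A B ⟶ tensorObj A' B'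
  leftUnitor (A : C) : tensorObj unit A ⟶ A
  rightUnitor (A : C) : A ⟶ tensorObj A unit
  associator (A B C : C) : tensorObj (tensorObj A B) C ⟶ tensorObj A (tensorObj B C)
  prod : C → C → C
  fst (A B : C) : prod A B ⟶ A
  snd (A B : C) : prod A B ⟶ B
  coprod : C → C → C
  inl (A B : C) : A ⟶ coprod A B
  inr (A B : C) : B ⟶ coprod A B

open DistSkewMonoidalStruct

/-- Distributive skew monoidal categories: skew monoidal categories with binary products and
coproducts such that the canonical morphism `(A ⊗ C) + (B ⊗ C) ⟶ (A + B) ⊗ C` is invertible. -/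
class DistSkewMonoidalCategory (C : Type u) [Category.{v} C] [DistSkewMonoidalStruct C] :
    Prop where
  -- `⊗` is a functor
  tensorHom_id (A B : C) : tensorHom (𝟙 A) (𝟙 B) = 𝟙 (tensorObj A B)
  tensorHom_comp {A A' A'' B B' B'' : C} (f : A ⟶ A') (f' : A' ⟶ A'') (g : B ⟶ B')
    (g' : B' ⟶ B'') : tensorHom (f ≫ f') (g ≫ g') = tensorHom f g ≫ tensorHom f' g'
  -- the structural laws are natural
  leftUnitor_naturality {A A' : C} (f : A ⟶ A') :
    tensorHom (𝟙 unit) f ≫ leftUnitor A' = leftUnitor A ≫ f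
  rightUnitor_naturality {A A' : C} (f : A ⟶ A') :
    f ≫ rightUnitor A' = rightUnitor A ≫ tensorHom f (𝟙 unit)
  associator_naturality {A A' B B' D D' : C} (f : A ⟶ A') (g : B ⟶ B') (h : D ⟶ D') :
    tensorHom (tensorHom f g) h ≫ associator A' B' D' =
      associator A B D ≫ tensorHom f (tensorHom g h)
  -- the five Mac Lane equations
  unit_unit : rightUnitor (unit : C) ≫ leftUnitor unit = 𝟙 unit
  triangle (A B : C) :
    tensorHom (rightUnitor A) (𝟙 B) ≫ associator A unit B ≫ tensorHom (𝟙 A) (leftUnitor B) =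
      𝟙 (tensorObj A B)
  associator_leftUnitor (A B : C) :
    associator unit A B ≫ leftUnitor (tensorObj A B) = tensorHom (leftUnitor A) (𝟙 B)
  rightUnitor_associator (A B : C) :
    rightUnitor (tensorObj A B) ≫ associator A B unit = tensorHom (𝟙 A) (rightUnitor B)
  pentagon (A B D E : C) :
    tensorHom (associator A B D) (𝟙 E) ≫ associator A (tensorObj B D) E ≫
        tensorHom (𝟙 A) (associator B D E) =
      associator (tensorObj A B) D E ≫ associator A B (tensorObj D E)
  -- binary products and coproducts
  prod_isLimit (A B : C) : Nonempty (IsLimit (BinaryFan.mk (fst A B) (snd A B)))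
  coprod_isColimit (A B : C) : Nonempty (IsColimit (BinaryCofan.mk (inl A B) (inr A B)))
  -- left-distributivity
  distrib (A B D : C) :
    IsIso (BinaryCofan.IsColimit.desc (coprod_isColimit (tensorObj A D) (tensorObj B D)).some
      (tensorHom (inl A B) (𝟙 D)) (tensorHom (inr A B) (𝟙 D)))

/-- Strict distributive skew monoidal functors: functors preserving the whole structure on the
nose. -/
structure IsStrictDistSkewMonoidal {C : Type u} [Category.{v} C] [DistSkewMonoidalStruct C]
    {D : Type*} [Category* D] [DistSkewMonoidalStruct D] (F : C ⥤ D) : Prop where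
  obj_unit : F.obj unit = unit
  obj_tensor (A B : C) : F.obj (tensorObj A B) = tensorObj (F.obj A) (F.obj B)
  map_tensor {A A' B B' : C} (f : A ⟶ A') (g : B ⟶ B') :
    F.map (tensorHom f g) =
      eqToHom (obj_tensor A B) ≫ tensorHom (F.map f) (F.map g) ≫ eqToHom (obj_tensor A' B').symm
  map_leftUnitor (A : C) :
    F.map (leftUnitor A) =
      eqToHom (by rw [obj_tensor, obj_unit]) ≫ leftUnitor (F.obj A)
  map_rightUnitor (A : C) :
    F.map (rightUnitor A) =
      rightUnitor (F.obj A) ≫ eqToHom (by rw [obj_tensor, obj_unit])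
  map_associator (A B E : C) :
    F.map (associator A B E) =
      eqToHom (by rw [obj_tensor, obj_tensor]) ≫
        associator (F.obj A) (F.obj B) (F.obj E) ≫ eqToHom (by rw [obj_tensor, obj_tensor])
  obj_prod (A B : C) : F.obj (prod A B) = prod (F.obj A) (F.obj B)
  map_fst (A B : C) : F.map (fst A B) = eqToHom (obj_prod A B) ≫ fst (F.obj A) (F.obj B)
  map_snd (A B : C) : F.map (snd A B) = eqToHom (obj_prod A B) ≫ snd (F.obj A) (F.obj B)
  obj_coprod (A B : C) : F.obj (coprod A B) = coprod (F.obj A) (F.obj B)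
  map_inl (A B : C) :
    F.map (inl A B) = inl (F.obj A) (F.obj B) ≫ eqToHom (obj_coprod A B).symm
  map_inr (A B : C) :
    F.map (inr A B) = inr (F.obj A) (F.obj B) ≫ eqToHom (obj_coprod A B).symm

/-! ## The syntactic category -/

/-- The objects of the syntactic category. -/
abbrev FDSkM (At : Type u) : Type u := Fma At

namespace FDSkM

/-- Derivations `A ∣ ⊢ B` modulo `≗`, with `ax` as identities and `scut` as composition, form a
category: `scut` is well defined modulo `≗`, unital and associative. -/
structure CategoryLaws (At : Type u) : Prop where
  scut_congr {A B C : Fma At} {f f' : Deriv (some A) [] B} {g g' : Deriv (some B) [] C} :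
    f.Eqv f' → g.Eqv g' → (f.scut g).Eqv (f'.scut g')
  ax_scut {A B : Fma At} (f : Deriv (some A) [] B) : ((Deriv.ax A).scut f).Eqv f
  scut_ax {A B : Fma At} (f : Deriv (some A) [] B) : (f.scut (Deriv.ax B)).Eqv f
  scut_assoc {A B C D : Fma At} (f : Deriv (some A) [] B) (g : Deriv (some B) [] C)
    (h : Deriv (some C) [] D) : ((f.scut g).scut h).Eqv (f.scut (g.scut h))

/-- The syntactic category: maps `A ⟶ B` are derivations `A ∣ ⊢ B` modulo `≗`, identities are the
classes of `ax`, composition is `scut`. -/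
abbrev category (L : CategoryLaws At) : Category.{u} (FDSkM At) where
  Hom A B := Quotient (Deriv.setoid (some A) [] B)
  id A := Quotient.mk _ (Deriv.ax A)
  comp := Quotient.map₂ (fun f g => f.scut g) (fun _ _ h _ _ h' => L.scut_congr h h')
  id_comp f := Quotient.inductionOn f fun f => Quotient.sound (L.ax_scut f)
  comp_id f := Quotient.inductionOn f fun f => Quotient.sound (L.scut_ax f)
  assoc f g h := Quotient.inductionOn₃ f g h fun f g h => Quotient.sound (L.scut_assoc f g h)

open Deriv in
/-- The structure of the syntactic category: unit and tensor are the multiplicative connectives,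
products and coproducts are the additive connectives. -/
abbrev struct (L : CategoryLaws At) :
    letI := category L
    DistSkewMonoidalStruct (FDSkM At) :=
  letI := category L
  { unit := .unit
    tensorObj := .tensor
    tensorHom := Quotient.map₂ (fun f g => tensorL (tensorR f (pass g)))
      (fun _ _ h _ _ h' => .tensorL (.tensorR h (.pass h')))
    leftUnitor := fun A => Quotient.mk _ (tensorL (unitL (pass (ax A))))
    rightUnitor := fun A => Quotient.mk _ (tensorR (ax A) unitR)
    associator := fun A B C => Quotient.mk _
      (tensorL (tensorL (tensorR (ax A) (pass (tensorR (ax B) (pass (ax C)))))))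
    prod := .conj
    fst := fun A _ => Quotient.mk _ (conjL₁ (ax A))
    snd := fun _ B => Quotient.mk _ (conjL₂ (ax B))
    coprod := .disj
    inl := fun A _ => Quotient.mk _ (disjR₁ (ax A))
    inr := fun _ B => Quotient.mk _ (disjR₂ (ax B)) }

end FDSkM

end SkewLogic

namespace SkewLogic

open DistSkewMonoidalStruct

/-- `i` and `j` are the injections of a binary coproduct. -/
def IsSum {C : Type w} [Category.{v} C] {A B P : C} (i : A ⟶ P) (j : B ⟶ P) : Prop :=
  ∀ ⦃Z : C⦄ (f : A ⟶ Z) (g : B ⟶ Z), ∃! h : P ⟶ Z, i ≫ h = f ∧ j ≫ h = g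

theorem IsSum.isIso_desc {C : Type w} [Category.{v} C] {A B P Q : C} {i : A ⟶ P} {j : B ⟶ P}
    (hs : IsSum i j) {i' : A ⟶ Q} {j' : B ⟶ Q} (c : IsColimit (BinaryCofan.mk i' j')) :
    IsIso (BinaryCofan.IsColimit.desc c i j) := by
  have hl : i' ≫ BinaryCofan.IsColimit.desc c i j = i := c.fac (BinaryCofan.mk i j) ⟨.left⟩
  have hr : j' ≫ BinaryCofan.IsColimit.desc c i j = j := c.fac (BinaryCofan.mk i j) ⟨.right⟩
  obtain ⟨k, ⟨hk₁, hk₂⟩, -⟩ := hs i' j'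
  refine ⟨k, BinaryCofan.IsColimit.hom_ext c ?_ ?_, (hs i j).unique ⟨?_, ?_⟩ (by simp)⟩
  · exact (Category.assoc _ _ _).symm.trans
      ((congrArg (· ≫ k) hl).trans (hk₁.trans (Category.comp_id _).symm))
  · exact (Category.assoc _ _ _).symm.trans
      ((congrArg (· ≫ k) hr).trans (hk₂.trans (Category.comp_id _).symm))
  · exact (Category.assoc _ _ _).symm.trans ((congrArg (· ≫ _) hk₁).trans hl)
  · exact (Category.assoc _ _ _).symm.trans ((congrArg (· ≫ _) hk₂).trans hr)

theorem IsSum.nonempty_isColimit {C : Type w} [Category.{v} C] {A B P : C} {i : A ⟶ P}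
    {j : B ⟶ P} (hs : IsSum i j) : Nonempty (IsColimit (BinaryCofan.mk i j)) :=
  ⟨BinaryCofan.IsColimit.mk _ (fun f g => (hs f g).choose)
    (fun f g => (hs f g).choose_spec.1.1) (fun f g => (hs f g).choose_spec.1.2)
    (fun f g _ h₁ h₂ => (hs f g).choose_spec.2 _ ⟨h₁, h₂⟩)⟩

section Contexts

variable {C : Type w} [Category.{v} C] [DistSkewMonoidalStruct C] {Ob : Type u} (o : Ob → C)

/-- The left-nested tensor product `(X ⊗ o A₁) ⊗ ⋯ ⊗ o Aₙ`. -/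
@[reducible] def ctx : C → List Ob → C
  | X, [] => X
  | X, A :: Γ => ctx (tensorObj X (o A)) Γ

/-- Functoriality of `ctx` in its head. -/
def ctxMap : {X Y : C} → (X ⟶ Y) → (Γ : List Ob) → (ctx o X Γ ⟶ ctx o Y Γ)
  | _, _, f, [] => f
  | _, _, f, A :: Γ => ctxMap (tensorHom f (𝟙 (o A))) Γ

/-- Composition along the head: the semantic counterpart of `Deriv.scut`. -/
def stoupCut {Y Z : C} {Δ : List Ob} : {X : C} → (Γ : List Ob) → (ctx o X Γ ⟶ Y) →
    (ctx o Y Δ ⟶ Z) → (ctx o X (Γ ++ Δ) ⟶ Z)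
  | _, [], f, g => ctxMap o f Δ ≫ g
  | X, A :: Γ, f, g => stoupCut (X := tensorObj X (o A)) Γ f g

/-- Iterated associators. -/
def assocCtx (X : C) : (Y : C) → (Γ : List Ob) →
    (ctx o (tensorObj X Y) Γ ⟶ tensorObj X (ctx o Y Γ))
  | _, [] => 𝟙 _
  | Y, A :: Γ => ctxMap o (associator X Y (o A)) Γ ≫ assocCtx X (tensorObj Y (o A)) Γ

/-- Tensoring a map out of a context with an object on the left. -/
def strength (X : C) {Y B : C} (Γ : List Ob) (g : ctx o Y Γ ⟶ B) :
    ctx o (tensorObj X Y) Γ ⟶ tensorObj X B :=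
  assocCtx o X Y Γ ≫ tensorHom (𝟙 X) g

/-- Tensoring a map out of a context headed by the unit with an object on the left. -/
def unitStrength (X : C) {B : C} (Γ : List Ob) (g : ctx o unit Γ ⟶ B) :
    ctx o X Γ ⟶ tensorObj X B :=
  ctxMap o (rightUnitor X) Γ ≫ strength o X Γ g

/-- Composition inside a context: the semantic counterpart of `Deriv.ccut`. -/
def ctxCut {A : Ob} {Z : C} (Γ : List Ob) {Δ₁ : List Ob} (f : ctx o unit Γ ⟶ o A) :
    {X : C} → (Δ₀ : List Ob) → (ctx o X (Δ₀ ++ A :: Δ₁) ⟶ Z) → (ctx o X (Δ₀ ++ (Γ ++ Δ₁)) ⟶ Z)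
  | X, [], g => stoupCut o Γ (unitStrength o X Γ f) g
  | X, B :: Δ₀, g => ctxCut Γ f (X := tensorObj X (o B)) Δ₀ g

/-- Transport of a map along an equality of contexts. -/
def castDom {X Y : C} {Γ Γ' : List Ob} (h : Γ = Γ') (f : ctx o X Γ ⟶ Y) : ctx o X Γ' ⟶ Y :=
  h ▸ f

variable {o}

theorem castDom_castDom {X Y : C} {Γ Γ' Γ'' : List Ob} (h : Γ = Γ') (h' : Γ' = Γ'')
    (f : ctx o X Γ ⟶ Y) : castDom o h' (castDom o h f) = castDom o (h.trans h') f := by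
  subst h h'; rfl

theorem castDom_cons {X Y : C} {A : Ob} {Γ Γ' : List Ob} (h : Γ = Γ') (h' : A :: Γ = A :: Γ')
    (f : ctx o X (A :: Γ) ⟶ Y) :
    castDom o h' f = castDom (X := tensorObj X (o A)) o h f := by
  subst h; rfl

theorem stoupCut_comp {X Y Z Z' : C} {Γ Δ : List Ob} (f : ctx o X Γ ⟶ Y) (g : ctx o Y Δ ⟶ Z)
    (k : Z ⟶ Z') : stoupCut o Γ f (g ≫ k) = stoupCut o Γ f g ≫ k := by
  induction Γ generalizing X with
  | nil => simp [stoupCut]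
  | cons A Γ ih => exact ih f

theorem stoupCut_id {X Y : C} {Γ : List Ob} (f : ctx o X Γ ⟶ Y) :
    stoupCut (Δ := []) o Γ f (𝟙 Y) = castDom o (Γ.append_nil).symm f := by
  induction Γ generalizing X with
  | nil => exact Category.comp_id _
  | cons A Γ ih => exact (ih f).trans (castDom_cons _ _ _).symm

theorem ctxCut_comp {X Z Z' : C} {A : Ob} {Γ Δ₀ Δ₁ : List Ob}
    (f : ctx o unit Γ ⟶ o A) (g : ctx o X (Δ₀ ++ A :: Δ₁) ⟶ Z) (k : Z ⟶ Z') :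
    ctxCut o Γ f Δ₀ (g ≫ k) = ctxCut o Γ f Δ₀ g ≫ k := by
  induction Δ₀ generalizing X with
  | nil => exact stoupCut_comp _ _ _
  | cons B Δ₀ ih => exact ih g

variable [DistSkewMonoidalCategory C]

open DistSkewMonoidalCategory

theorem ctxMap_id (X : C) (Γ : List Ob) : ctxMap o (𝟙 X) Γ = 𝟙 (ctx o X Γ) := by
  induction Γ generalizing X with
  | nil => rfl
  | cons A Γ ih => exact (congrArg (ctxMap o · Γ) (tensorHom_id X (o A))).trans (ih _)

theorem ctxMap_comp {X Y Z : C} (f : X ⟶ Y) (g : Y ⟶ Z) (Γ : List Ob) :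
    ctxMap o (f ≫ g) Γ = ctxMap o f Γ ≫ ctxMap o g Γ := by
  induction Γ generalizing X Y Z with
  | nil => rfl
  | cons A Γ ih =>
    refine .trans ?_ (ih _ _)
    exact congrArg (ctxMap o · Γ) (by rw [← tensorHom_comp, Category.comp_id])

theorem ctxMap_stoupCut {X X' Y Z : C} {Γ Δ : List Ob} (k : X' ⟶ X) (f : ctx o X Γ ⟶ Y)
    (g : ctx o Y Δ ⟶ Z) :
    ctxMap o k (Γ ++ Δ) ≫ stoupCut o Γ f g = stoupCut o Γ (ctxMap o k Γ ≫ f) g := by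
  induction Γ generalizing X X' with
  | nil => simp [stoupCut, ctxMap, ctxMap_comp]
  | cons A Γ ih => exact ih _ f

theorem stoupCut_ctxMap {X Y Y' Z : C} {Γ Δ : List Ob} (f : ctx o X Γ ⟶ Y) (k : Y ⟶ Y')
    (g : ctx o Y' Δ ⟶ Z) :
    stoupCut o Γ f (ctxMap o k Δ ≫ g) = stoupCut o Γ (f ≫ k) g := by
  induction Γ generalizing X with
  | nil => simp [stoupCut, ctxMap_comp]
  | cons A Γ ih => exact ih f

theorem id_stoupCut {X Z : C} {Δ : List Ob} (g : ctx o X Δ ⟶ Z) :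
    stoupCut o [] (𝟙 X) g = g := by
  simp [stoupCut, ctxMap_id]

theorem stoupCut_assoc {X Y Z W : C} {Γ Δ Λ : List Ob} (f : ctx o X Γ ⟶ Y) (g : ctx o Y Δ ⟶ Z)
    (h : ctx o Z Λ ⟶ W) :
    stoupCut o Γ f (stoupCut o Δ g h) =
      castDom o (Γ.append_assoc Δ Λ) (stoupCut o (Γ ++ Δ) (stoupCut o Γ f g) h) := by
  induction Γ generalizing X with
  | nil => exact ctxMap_stoupCut f g h
  | cons A Γ ih => exact (ih f).trans (castDom_cons _ _ _).symm

theorem assocCtx_naturality {X X' Y Y' : C} (f : X ⟶ X') (g : Y ⟶ Y') (Γ : List Ob) :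
    ctxMap o (tensorHom f g) Γ ≫ assocCtx o X' Y' Γ =
      assocCtx o X Y Γ ≫ tensorHom f (ctxMap o g Γ) := by
  induction Γ generalizing Y Y' with
  | nil => exact (Category.comp_id _).trans (Category.id_comp _).symm
  | cons A Γ ih =>
    simp only [assocCtx, ctxMap, Category.assoc]
    rw [← ih, ← Category.assoc, ← Category.assoc, ← ctxMap_comp, ← ctxMap_comp,
      associator_naturality]

theorem unitStrength_naturality {X X' B : C} {Γ : List Ob} (k : X' ⟶ X)
    (f : ctx o unit Γ ⟶ B) :
    ctxMap o k Γ ≫ unitStrength o X Γ f = unitStrength o X' Γ f ≫ tensorHom k (𝟙 B) := by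
  simp only [unitStrength, strength, Category.assoc]
  rw [← tensorHom_comp, Category.id_comp, Category.comp_id, ← Category.assoc, ← ctxMap_comp,
    rightUnitor_naturality, ctxMap_comp, Category.assoc,
    reassoc_of% (assocCtx_naturality (o := o) k (𝟙 unit) Γ), ← tensorHom_comp, ctxMap_id,
    Category.id_comp, Category.comp_id]

theorem ctxMap_ctxCut {X X' Z : C} {A : Ob} {Γ Δ₀ Δ₁ : List Ob} (k : X' ⟶ X)
    (f : ctx o unit Γ ⟶ o A) (g : ctx o X (Δ₀ ++ A :: Δ₁) ⟶ Z) :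
    ctxMap o k (Δ₀ ++ (Γ ++ Δ₁)) ≫ ctxCut o Γ f Δ₀ g =
      ctxCut o Γ f Δ₀ (ctxMap o k (Δ₀ ++ A :: Δ₁) ≫ g) := by
  induction Δ₀ generalizing X X' with
  | nil =>
    simp only [ctxCut, List.nil_append]
    rw [ctxMap_stoupCut, unitStrength_naturality]
    exact (stoupCut_ctxMap _ _ _).symm
  | cons B Δ₀ ih => exact ih _ g

theorem assocCtx_leftUnitor (Y : C) (Γ : List Ob) :
    assocCtx o unit Y Γ ≫ leftUnitor (ctx o Y Γ) = ctxMap o (leftUnitor Y) Γ := by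
  induction Γ generalizing Y with
  | nil => exact Category.id_comp _
  | cons A Γ ih =>
    simp only [assocCtx, ctxMap, Category.assoc]
    refine (congrArg (_ ≫ ·) (ih _)).trans ?_
    rw [← ctxMap_comp, associator_leftUnitor]

theorem assocCtx_pentagon (X Y Z : C) (Γ : List Ob) :
    assocCtx o (tensorObj X Y) Z Γ ≫ associator X Y (ctx o Z Γ) =
      ctxMap o (associator X Y Z) Γ ≫ assocCtx o X (tensorObj Y Z) Γ ≫
        tensorHom (𝟙 X) (assocCtx o Y Z Γ) := by
  induction Γ generalizing Z with
  | nil => simp [assocCtx, ctxMap, ctx, tensorHom_id]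
  | cons A Γ ih =>
    simp only [assocCtx, ctxMap, Category.assoc]
    refine (congrArg (_ ≫ ·) (ih _)).trans ?_
    rw [← Category.assoc, ← ctxMap_comp, ← pentagon, ctxMap_comp, ctxMap_comp]
    simp only [Category.assoc]
    rw [← Category.assoc (ctxMap o (tensorHom (𝟙 X) _) Γ), assocCtx_naturality, Category.assoc,
      ← tensorHom_comp, Category.id_comp]

theorem strength_stoupCut (X : C) {Y Z B : C} {Γ Δ : List Ob} (f : ctx o Y Γ ⟶ Z)
    (g : ctx o Z Δ ⟶ B) :
    strength o X (Γ ++ Δ) (stoupCut o Γ f g) =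
      stoupCut o Γ (strength o X Γ f) (strength o X Δ g) := by
  induction Γ generalizing Y with
  | nil =>
    simp only [stoupCut, strength, assocCtx, List.nil_append, Category.id_comp]
    rw [← Category.assoc, assocCtx_naturality, Category.assoc, ← tensorHom_comp, Category.id_comp]
  | cons A Γ ih =>
    have := congrArg (ctxMap o (associator X Y (o A)) (Γ ++ Δ) ≫ ·) (ih f)
    refine .trans ?_ (this.trans ?_)
    · simp [strength, assocCtx, stoupCut]
    · simp only [ctxMap_stoupCut]
      simp [strength, assocCtx, stoupCut]

theorem unitStrength_associator (X Y : C) {B : C} {Γ : List Ob} (f : ctx o unit Γ ⟶ B) :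
    unitStrength o (tensorObj X Y) Γ f ≫ associator X Y B =
      strength o X Γ (unitStrength o Y Γ f) := by
  have h := assocCtx_naturality (o := o) (𝟙 X) (rightUnitor Y) Γ
  have h' := assocCtx_pentagon (o := o) X Y unit Γ
  have h'' := associator_naturality (𝟙 X) (𝟙 Y) f
  rw [tensorHom_id] at h''
  simp only [unitStrength, strength, Category.assoc, h'']
  rw [reassoc_of% h', ← Category.id_comp (𝟙 X), tensorHom_comp, Category.id_comp,
    ← reassoc_of% h, ← rightUnitor_associator, ctxMap_comp, ← Category.id_comp (𝟙 X),
    tensorHom_comp]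
  simp

theorem unitStrength_comp (X : C) {B B' : C} {Γ : List Ob} (f : ctx o unit Γ ⟶ B) (k : B ⟶ B') :
    unitStrength o X Γ (f ≫ k) = unitStrength o X Γ f ≫ tensorHom (𝟙 X) k := by
  simp only [unitStrength, strength, Category.assoc]
  rw [← tensorHom_comp, Category.comp_id]

theorem unitStrength_stoupCut (X : C) {Z B : C} {Γ Δ : List Ob} (f : ctx o unit Γ ⟶ Z)
    (g : ctx o Z Δ ⟶ B) :
    unitStrength o X (Γ ++ Δ) (stoupCut o Γ f g) =
      stoupCut o Γ (unitStrength o X Γ f) (strength o X Δ g) := by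
  simp only [unitStrength]
  rw [strength_stoupCut, ctxMap_stoupCut]

theorem ctxCut_strength (X : C) {Y B : C} {A : Ob} {Γ Δ₀ Δ₁ : List Ob}
    (f : ctx o unit Γ ⟶ o A) (g : ctx o Y (Δ₀ ++ A :: Δ₁) ⟶ B) :
    ctxCut o Γ f Δ₀ (strength o X (Δ₀ ++ A :: Δ₁) g) =
      strength o X (Δ₀ ++ (Γ ++ Δ₁)) (ctxCut o Γ f Δ₀ g) := by
  induction Δ₀ generalizing Y with
  | nil =>
    simp only [ctxCut, List.nil_append]
    rw [strength_stoupCut, ← unitStrength_associator, ← stoupCut_ctxMap]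
    simp only [strength, assocCtx, Category.assoc]
  | cons B Δ₀ ih =>
    simp only [ctxCut, List.cons_append]
    have := congrArg (ctxMap o (associator X Y (o B)) (Δ₀ ++ (Γ ++ Δ₁)) ≫ ·) (ih g)
    simp only [ctxMap_ctxCut] at this
    simpa only [strength, assocCtx, Category.assoc] using this

theorem ctxCut_unitStrength (X : C) {B : C} {A : Ob} {Γ Δ₀ Δ₁ : List Ob}
    (f : ctx o unit Γ ⟶ o A) (g : ctx o unit (Δ₀ ++ A :: Δ₁) ⟶ B) :
    ctxCut o Γ f Δ₀ (unitStrength o X (Δ₀ ++ A :: Δ₁) g) =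
      unitStrength o X (Δ₀ ++ (Γ ++ Δ₁)) (ctxCut o Γ f Δ₀ g) := by
  simp only [unitStrength]
  rw [← ctxMap_ctxCut, ctxCut_strength]

theorem unitStrength_leftUnitor {B : C} {Γ : List Ob} (f : ctx o unit Γ ⟶ B) :
    unitStrength o unit Γ f ≫ leftUnitor B = f := by
  simp only [unitStrength, strength, Category.assoc]
  rw [leftUnitor_naturality, ← Category.assoc (assocCtx _ _ _ _), assocCtx_leftUnitor,
    ← Category.assoc, ← ctxMap_comp, unit_unit, ctxMap_id, Category.id_comp]

theorem ctxCut_stoupCut_left {X Y Z : C} {A : Ob} {Γ Δ₀ Λ Δ : List Ob}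
    (f : ctx o unit Γ ⟶ o A) (g : ctx o X (Δ₀ ++ A :: Λ) ⟶ Y) (k : ctx o Y Δ ⟶ Z) :
    ctxCut o Γ f Δ₀ (castDom o (by simp) (stoupCut o (Δ₀ ++ A :: Λ) g k) :
        ctx o X (Δ₀ ++ A :: (Λ ++ Δ)) ⟶ Z) =
      castDom o (by simp) (stoupCut o (Δ₀ ++ (Γ ++ Λ)) (ctxCut o Γ f Δ₀ g) k) := by
  induction Δ₀ generalizing X with
  | nil => exact stoupCut_assoc _ _ _
  | cons B Δ₀ ih =>
    exact ((congrArg (ctxCut (X := tensorObj X (o B)) o Γ f Δ₀) (castDom_cons _ _ _)).trans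
      (ih g)).trans (castDom_cons _ _ _).symm

theorem ctxCut_stoupCut_right {X Y Z : C} {A : Ob} {Γ Γ' Λ Δ : List Ob}
    (f : ctx o unit Γ ⟶ o A) (g : ctx o X Γ' ⟶ Y) (k : ctx o Y (Λ ++ A :: Δ) ⟶ Z) :
    ctxCut o Γ f (Γ' ++ Λ) (castDom o (by simp) (stoupCut o Γ' g k) :
        ctx o X ((Γ' ++ Λ) ++ A :: Δ) ⟶ Z) =
      castDom o (by simp) (stoupCut o Γ' g (ctxCut o Γ f Λ k)) := by
  induction Γ' generalizing X with
  | nil => exact (ctxMap_ctxCut _ _ _).symm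
  | cons B Γ' ih =>
    exact ((congrArg (ctxCut (X := tensorObj X (o B)) o Γ f (Γ' ++ Λ)) (castDom_cons _ _ _)).trans
      (ih g)).trans (castDom_cons _ _ _).symm

variable (o) in
theorem unitStrength_singleton (X : C) (A : Ob) :
    unitStrength o X [A] (leftUnitor (o A)) = 𝟙 (tensorObj X (o A)) := by
  simp only [unitStrength, strength, assocCtx, ctxMap, Category.comp_id]
  exact triangle _ _

/-- Pairing into the chosen product. -/
noncomputable def pair {X A B : C} (f : X ⟶ A) (g : X ⟶ B) : X ⟶ prod A B :=
  (prod_isLimit A B).some.lift (BinaryFan.mk f g)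

theorem pair_fst {X A B : C} (f : X ⟶ A) (g : X ⟶ B) : pair f g ≫ fst A B = f :=
  (prod_isLimit A B).some.fac (BinaryFan.mk f g) ⟨.left⟩

theorem pair_snd {X A B : C} (f : X ⟶ A) (g : X ⟶ B) : pair f g ≫ snd A B = g :=
  (prod_isLimit A B).some.fac (BinaryFan.mk f g) ⟨.right⟩

theorem prod_hom_ext {X A B : C} {f g : X ⟶ prod A B} (h₁ : f ≫ fst A B = g ≫ fst A B)
    (h₂ : f ≫ snd A B = g ≫ snd A B) : f = g :=
  BinaryFan.IsLimit.hom_ext (prod_isLimit A B).some h₁ h₂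

theorem comp_pair {X Y A B : C} (k : X ⟶ Y) (f : Y ⟶ A) (g : Y ⟶ B) :
    k ≫ pair f g = pair (k ≫ f) (k ≫ g) :=
  prod_hom_ext (by simp only [Category.assoc, pair_fst]) (by simp only [Category.assoc, pair_snd])

theorem pair_fst_snd (A B : C) : pair (fst A B) (snd A B) = 𝟙 (prod A B) :=
  prod_hom_ext (by rw [pair_fst, Category.id_comp]) (by rw [pair_snd, Category.id_comp])

theorem coprod_existsUnique {A B Z : C} (f : A ⟶ Z) (g : B ⟶ Z) :
    ∃! h : coprod A B ⟶ Z, inl A B ≫ h = f ∧ inr A B ≫ h = g := by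
  let c := (coprod_isColimit A B).some
  refine ⟨c.desc (BinaryCofan.mk f g),
    ⟨c.fac (BinaryCofan.mk f g) ⟨.left⟩, c.fac (BinaryCofan.mk f g) ⟨.right⟩⟩, fun h hh => ?_⟩
  exact BinaryCofan.IsColimit.hom_ext c
    (hh.1.trans (c.fac (BinaryCofan.mk f g) ⟨.left⟩).symm)
    (hh.2.trans (c.fac (BinaryCofan.mk f g) ⟨.right⟩).symm)

theorem coprod_tensor_existsUnique {A B D Z : C} (f : tensorObj A D ⟶ Z) (g : tensorObj B D ⟶ Z) :
    ∃! h : tensorObj (coprod A B) D ⟶ Z,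
      tensorHom (inl A B) (𝟙 D) ≫ h = f ∧ tensorHom (inr A B) (𝟙 D) ≫ h = g := by
  obtain ⟨e, _, hl, hr⟩ : ∃ e : coprod (tensorObj A D) (tensorObj B D) ⟶
      tensorObj (coprod A B) D, IsIso e ∧ inl _ _ ≫ e = tensorHom (inl A B) (𝟙 D) ∧
        inr _ _ ≫ e = tensorHom (inr A B) (𝟙 D) :=
    ⟨_, distrib A B D, (coprod_isColimit _ _).some.fac (BinaryCofan.mk _ _) ⟨.left⟩,
      (coprod_isColimit _ _).some.fac (BinaryCofan.mk _ _) ⟨.right⟩⟩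
  obtain ⟨h, hh, hu⟩ := coprod_existsUnique f g
  refine ⟨inv e ≫ h, ⟨?_, ?_⟩, fun k hk => ?_⟩
  · rw [← hl, Category.assoc, IsIso.hom_inv_id_assoc, hh.1]
  · rw [← hr, Category.assoc, IsIso.hom_inv_id_assoc, hh.2]
  · rw [IsIso.eq_inv_comp]
    exact hu _ ⟨by rw [← Category.assoc, hl, hk.1], by rw [← Category.assoc, hr, hk.2]⟩

theorem IsSum.tensor {A B P : C} {i : A ⟶ P} {j : B ⟶ P} (hs : IsSum i j) (D : C) :
    IsSum (tensorHom i (𝟙 D)) (tensorHom j (𝟙 D)) := by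
  obtain ⟨e, ⟨he₁, he₂⟩, -⟩ := coprod_existsUnique i j
  obtain ⟨e', ⟨he₁', he₂'⟩, -⟩ := hs (inl A B) (inr A B)
  have h₁ : e ≫ e' = 𝟙 _ := (coprod_existsUnique (inl A B) (inr A B)).unique
    ⟨by rw [← Category.assoc, he₁, he₁'], by rw [← Category.assoc, he₂, he₂']⟩ (by simp)
  have h₂ : e' ≫ e = 𝟙 _ := (hs i j).unique
    ⟨by rw [← Category.assoc, he₁', he₁], by rw [← Category.assoc, he₂', he₂]⟩ (by simp)
  intro Z f g
  obtain ⟨h, hh, hu⟩ := coprod_tensor_existsUnique f g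
  refine ⟨tensorHom e' (𝟙 D) ≫ h, ⟨?_, ?_⟩, fun k hk => ?_⟩
  · rw [← Category.assoc, ← tensorHom_comp, he₁', Category.id_comp, hh.1]
  · rw [← Category.assoc, ← tensorHom_comp, he₂', Category.id_comp, hh.2]
  · rw [← hu (tensorHom e (𝟙 D) ≫ k), ← Category.assoc, ← tensorHom_comp, h₂, Category.id_comp,
      tensorHom_id, Category.id_comp]
    constructor
    · rw [← Category.assoc, ← tensorHom_comp, he₁, Category.id_comp, hk.1]
    · rw [← Category.assoc, ← tensorHom_comp, he₂, Category.id_comp, hk.2]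

theorem IsSum.ctx {A B P : C} {i : A ⟶ P} {j : B ⟶ P} (hs : IsSum i j) (Γ : List Ob) :
    IsSum (ctxMap o i Γ) (ctxMap o j Γ) := by
  induction Γ generalizing A B P with
  | nil => exact hs
  | cons D Γ ih => exact ih (hs.tensor (o D))

variable (o) in
/-- Case distinction on the head of a context. -/
noncomputable def caseHead {A B Z : C} (Γ : List Ob) (f : ctx o A Γ ⟶ Z) (g : ctx o B Γ ⟶ Z) :
    ctx o (coprod A B) Γ ⟶ Z :=
  (IsSum.ctx (fun _ => coprod_existsUnique) Γ f g).choose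

theorem inl_caseHead {A B Z : C} {Γ : List Ob} (f : ctx o A Γ ⟶ Z) (g : ctx o B Γ ⟶ Z) :
    ctxMap o (inl A B) Γ ≫ caseHead o Γ f g = f :=
  (IsSum.ctx (fun _ => coprod_existsUnique) Γ f g).choose_spec.1.1

theorem inr_caseHead {A B Z : C} {Γ : List Ob} (f : ctx o A Γ ⟶ Z) (g : ctx o B Γ ⟶ Z) :
    ctxMap o (inr A B) Γ ≫ caseHead o Γ f g = g :=
  (IsSum.ctx (fun _ => coprod_existsUnique) Γ f g).choose_spec.1.2

theorem caseHead_ext {A B Z : C} {Γ : List Ob} {f g : ctx o (coprod A B) Γ ⟶ Z}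
    (h₁ : ctxMap o (inl A B) Γ ≫ f = ctxMap o (inl A B) Γ ≫ g)
    (h₂ : ctxMap o (inr A B) Γ ≫ f = ctxMap o (inr A B) Γ ≫ g) : f = g :=
  (IsSum.ctx (fun _ => coprod_existsUnique) Γ _ _).unique ⟨h₁, h₂⟩ ⟨rfl, rfl⟩

theorem caseHead_comp {A B Z Z' : C} {Γ : List Ob} (f : ctx o A Γ ⟶ Z) (g : ctx o B Γ ⟶ Z)
    (k : Z ⟶ Z') : caseHead o Γ f g ≫ k = caseHead o Γ (f ≫ k) (g ≫ k) :=
  caseHead_ext (by rw [← Category.assoc, inl_caseHead, inl_caseHead])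
    (by rw [← Category.assoc, inr_caseHead, inr_caseHead])

theorem caseHead_stoupCut {A B Y Z : C} {Γ Δ : List Ob} (f : ctx o A Γ ⟶ Y) (g : ctx o B Γ ⟶ Y)
    (k : ctx o Y Δ ⟶ Z) :
    stoupCut o Γ (caseHead o Γ f g) k =
      caseHead o (Γ ++ Δ) (stoupCut o Γ f k) (stoupCut o Γ g k) :=
  caseHead_ext (by rw [ctxMap_stoupCut, inl_caseHead, inl_caseHead])
    (by rw [ctxMap_stoupCut, inr_caseHead, inr_caseHead])

theorem ctxCut_caseHead {A : Ob} {B D Z : C} {Γ Δ₀ Δ₁ : List Ob} (f : ctx o unit Γ ⟶ o A)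
    (g : ctx o B (Δ₀ ++ A :: Δ₁) ⟶ Z) (k : ctx o D (Δ₀ ++ A :: Δ₁) ⟶ Z) :
    ctxCut o Γ f Δ₀ (caseHead o (Δ₀ ++ A :: Δ₁) g k) =
      caseHead o (Δ₀ ++ (Γ ++ Δ₁)) (ctxCut o Γ f Δ₀ g) (ctxCut o Γ f Δ₀ k) :=
  caseHead_ext (by rw [ctxMap_ctxCut, inl_caseHead, inl_caseHead])
    (by rw [ctxMap_ctxCut, inr_caseHead, inr_caseHead])

theorem stoupCut_pair {X Y A B : C} {Γ Δ : List Ob} (f : ctx o X Γ ⟶ Y) (g : ctx o Y Δ ⟶ A)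
    (k : ctx o Y Δ ⟶ B) :
    stoupCut o Γ f (pair g k) = pair (stoupCut o Γ f g) (stoupCut o Γ f k) :=
  prod_hom_ext (by rw [← stoupCut_comp, pair_fst, pair_fst])
    (by rw [← stoupCut_comp, pair_snd, pair_snd])

theorem ctxCut_pair {X D B : C} {A : Ob} {Γ Δ₀ Δ₁ : List Ob}
    (f : ctx o unit Γ ⟶ o A) (g : ctx o X (Δ₀ ++ A :: Δ₁) ⟶ D)
    (k : ctx o X (Δ₀ ++ A :: Δ₁) ⟶ B) :
    ctxCut o Γ f Δ₀ (pair g k) = pair (ctxCut o Γ f Δ₀ g) (ctxCut o Γ f Δ₀ k) :=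
  prod_hom_ext (by rw [← ctxCut_comp, pair_fst, pair_fst])
    (by rw [← ctxCut_comp, pair_snd, pair_snd])

end Contexts

end SkewLogic

namespace SkewLogic

open DistSkewMonoidalStruct DistSkewMonoidalCategory

section Interpretation

variable {At : Type u} {C : Type w} [Category.{v} C] [DistSkewMonoidalStruct C]

/-- The interpretation of formulae. -/
@[reducible] def Fma.interp (a : At → C) : Fma At → C
  | .atom X => a X
  | .unit => DistSkewMonoidalStruct.unit
  | .tensor A B => tensorObj (A.interp a) (B.interp a)
  | .conj A B => prod (A.interp a) (B.interp a)
  | .disj A B => coprod (A.interp a) (B.interp a)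

/-- The interpretation of stoups. -/
@[reducible] def stoupInterp (a : At → C) : Option (Fma At) → C
  | none => unit
  | some A => A.interp a

variable [DistSkewMonoidalCategory C]

/-- The interpretation of derivations. -/
noncomputable def Deriv.interp (a : At → C) :
    {S : Option (Fma At)} → {Γ : List (Fma At)} → {A : Fma At} → Deriv S Γ A →
      (ctx (Fma.interp a) (stoupInterp a S) Γ ⟶ A.interp a)
  | _, _, _, ax A => 𝟙 (A.interp a)
  | _, _, _, pass (A := A) (Γ := Γ) f =>
      ctxMap (Fma.interp a) (leftUnitor (A.interp a)) Γ ≫ f.interp a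
  | _, _, _, unitL f => f.interp a
  | _, _, _, unitR => 𝟙 DistSkewMonoidalStruct.unit
  | _, _, _, tensorL f => f.interp a
  | _, _, _, tensorR (Γ := Γ) (Δ := Δ) (A := A) f g =>
      stoupCut (Fma.interp a) Γ (f.interp a)
        (unitStrength (Fma.interp a) (A.interp a) Δ (g.interp a))
  | _, _, _, conjL₁ (A := A) (B := B) (Γ := Γ) f =>
      ctxMap (Fma.interp a) (fst (A.interp a) (B.interp a)) Γ ≫ f.interp a
  | _, _, _, conjL₂ (A := A) (B := B) (Γ := Γ) f =>
      ctxMap (Fma.interp a) (snd (A.interp a) (B.interp a)) Γ ≫ f.interp a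
  | _, _, _, conjR f g => pair (f.interp a) (g.interp a)
  | _, _, _, disjL (Γ := Γ) f g => caseHead (Fma.interp a) Γ (f.interp a) (g.interp a)
  | _, _, _, disjR₁ f => f.interp a ≫ inl _ _
  | _, _, _, disjR₂ f => f.interp a ≫ inr _ _

variable (a : At → C)

theorem Deriv.interp_castCtx {S : Option (Fma At)} {Γ Γ' : List (Fma At)} {A : Fma At}
    (h : Γ = Γ') (f : Deriv S Γ A) :
    (castCtx h f).interp a = castDom (Fma.interp a) h (f.interp a) := by
  subst h; rfl

theorem Deriv.Eqv.interp_eq {S : Option (Fma At)} {Γ : List (Fma At)} {A : Fma At}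
    {f g : Deriv S Γ A} (h : f.Eqv g) : f.interp a = g.interp a := by
  induction h with
  | refl => rfl
  | symm _ ih => exact ih.symm
  | trans _ _ ih₁ ih₂ => exact ih₁.trans ih₂
  | pass _ ih | unitL _ ih | tensorL _ ih | conjL₁ _ ih | conjL₂ _ ih | disjR₁ _ ih
  | disjR₂ _ ih => simp only [Deriv.interp, ih]
  | tensorR _ _ ih₁ ih₂ | conjR _ _ ih₁ ih₂ | disjL _ _ ih₁ ih₂ =>
    simp only [Deriv.interp, ih₁, ih₂]
  | ax_unit => rfl
  | ax_tensor A B =>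
    refine .symm ((id_stoupCut _).trans ?_)
    refine .trans ?_ (unitStrength_singleton (Fma.interp a) (A.interp a) B)
    simp only [Deriv.interp, ctxMap, Category.comp_id]
  | ax_conj A B =>
    simp only [Deriv.interp, ctxMap, Category.comp_id]
    exact (pair_fst_snd _ _).symm
  | ax_disj A B =>
    apply caseHead_ext (Γ := [])
    · exact (Category.comp_id _).trans ((Category.id_comp _).symm.trans (inl_caseHead _ _).symm)
    · exact (Category.comp_id _).trans ((Category.id_comp _).symm.trans (inr_caseHead _ _).symm)
  | tensorR_pass | tensorR_conjL₁ | tensorR_conjL₂ =>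
    simp only [Deriv.interp]
    exact (ctxMap_stoupCut _ _ _).symm
  | tensorR_unitL => rfl
  | tensorR_tensorL => rfl
  | tensorR_disjL => exact caseHead_stoupCut _ _ _
  | pass_conjR | conjL₁_conjR | conjL₂_conjR => exact comp_pair _ _ _
  | unitL_conjR => rfl
  | tensorL_conjR => rfl
  | disjL_conjR => 
    apply prod_hom_ext <;>
    simp only [Deriv.interp, caseHead_comp, pair_fst, pair_snd]
  | disjR₁_pass | disjR₁_conjL₁ | disjR₁_conjL₂ | disjR₂_pass | disjR₂_conjL₁ | disjR₂_conjL₂ =>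
    exact Category.assoc _ _ _
  | disjR₁_unitL => rfl
  | disjR₁_tensorL => rfl
  | disjR₁_disjL => exact caseHead_comp _ _ _
  | disjR₂_unitL => rfl
  | disjR₂_tensorL => rfl
  | disjR₂_disjL => exact caseHead_comp _ _ _

mutual

theorem Deriv.interp_scut {S : Option (Fma At)} {Γ : List (Fma At)} {A : Fma At}
    {Δ : List (Fma At)} {C : Fma At} (f : Deriv S Γ A) (g : Deriv (some A) Δ C) :
    (f.scut g).interp a = stoupCut (Fma.interp a) Γ (f.interp a) (g.interp a) :=
  match f, g with
  | ax _, g => by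
    rw [scut]
    exact (id_stoupCut _).symm
  | pass f, g => by
    rw [scut, interp, interp_scut f g]
    exact ctxMap_stoupCut _ _ _
  | unitL f, g => by
    rw [scut]
    exact interp_scut f g
  | tensorL f, g => by
    rw [scut]
    exact interp_scut f g
  | conjL₁ f, g => by
    rw [scut, interp, interp_scut f g]
    exact ctxMap_stoupCut _ _ _
  | conjL₂ f, g => by
    rw [scut, interp, interp_scut f g]
    exact ctxMap_stoupCut _ _ _
  | disjL f₁ f₂, g => by
    rw [scut, interp, interp_scut f₁ g, interp_scut f₂ g]
    exact (caseHead_stoupCut _ _ _).symm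
  | unitR, ax _ => by
    rw [scut]
    exact (id_stoupCut _).symm
  | unitR, unitL g => by
    rw [scut]
    exact (id_stoupCut _).symm
  | unitR, tensorR g₁ g₂ => by
    rw [scut]
    exact (congrArg (stoupCut _ _ · _) 
      ((interp_scut unitR g₁).trans (id_stoupCut _))).trans (id_stoupCut _).symm
  | unitR, conjR g₁ g₂ => by
    rw [scut]
    exact (congrArg₂ pair (interp_scut unitR g₁) (interp_scut unitR g₂)).trans
      (stoupCut_pair _ _ _).symm
  | unitR, disjR₁ g => by
    rw [scut]
    exact (congrArg (· ≫ inl _ _) (interp_scut unitR g)).trans (stoupCut_comp _ _ _).symm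
  | unitR, disjR₂ g => by
    rw [scut]
    exact (congrArg (· ≫ inr _ _) (interp_scut unitR g)).trans (stoupCut_comp _ _ _).symm
  | tensorR f₁ f₂, ax _ => by
    rw [scut, interp_castCtx]
    exact (stoupCut_id _).symm
  | tensorR f₁ f₂, tensorL g => by
    rw [scut, interp_castCtx, interp_scut f₁, interp_ccut [] f₂ g rfl]
    exact (congrArg (castDom _ _) (stoupCut_assoc _ _ _)).trans (castDom_castDom _ _ _)
  | tensorR f₁ f₂, tensorR g₁ g₂ => by
    rw [scut, interp_castCtx]
    exact (congrArg (fun t => castDom _ _ (stoupCut _ _ t _)) (interp_scut (tensorR f₁ f₂) g₁)).trans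
      (stoupCut_assoc _ _ _).symm
  | tensorR f₁ f₂, conjR g₁ g₂ => by
    rw [scut]
    exact (congrArg₂ pair (interp_scut (tensorR f₁ f₂) g₁) (interp_scut (tensorR f₁ f₂) g₂)).trans
      (stoupCut_pair _ _ _).symm
  | tensorR f₁ f₂, disjR₁ g => by
    rw [scut]
    exact (congrArg (· ≫ inl _ _) (interp_scut (tensorR f₁ f₂) g)).trans (stoupCut_comp _ _ _).symm
  | tensorR f₁ f₂, disjR₂ g => by
    rw [scut]
    exact (congrArg (· ≫ inr _ _) (interp_scut (tensorR f₁ f₂) g)).trans (stoupCut_comp _ _ _).symm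
  | conjR f₁ f₂, ax _ => by
    rw [scut, interp_castCtx]
    exact (stoupCut_id _).symm
  | conjR f₁ f₂, conjL₁ g => by
    rw [scut, interp_scut f₁ g]
    refine .trans ?_ (stoupCut_ctxMap _ _ _).symm
    exact congrArg (stoupCut _ _ · _) (pair_fst _ _).symm
  | conjR f₁ f₂, conjL₂ g => by
    rw [scut, interp_scut f₂ g]
    refine .trans ?_ (stoupCut_ctxMap _ _ _).symm
    exact congrArg (stoupCut _ _ · _) (pair_snd _ _).symm
  | conjR f₁ f₂, tensorR g₁ g₂ => by
    rw [scut, interp_castCtx]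
    exact (congrArg (fun t => castDom _ _ (stoupCut _ _ t _)) (interp_scut (conjR f₁ f₂) g₁)).trans
      (stoupCut_assoc _ _ _).symm
  | conjR f₁ f₂, conjR g₁ g₂ => by
    rw [scut]
    exact (congrArg₂ pair (interp_scut (conjR f₁ f₂) g₁) (interp_scut (conjR f₁ f₂) g₂)).trans
      (stoupCut_pair _ _ _).symm
  | conjR f₁ f₂, disjR₁ g => by
    rw [scut]
    exact (congrArg (· ≫ inl _ _) (interp_scut (conjR f₁ f₂) g)).trans (stoupCut_comp _ _ _).symm
  | conjR f₁ f₂, disjR₂ g => by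
    rw [scut]
    exact (congrArg (· ≫ inr _ _) (interp_scut (conjR f₁ f₂) g)).trans (stoupCut_comp _ _ _).symm
  | disjR₁ f, ax _ => by
    rw [scut, interp_castCtx]
    exact (stoupCut_id _).symm
  | disjR₁ f, disjL g₁ g₂ => by
    rw [scut, interp_scut f g₁, ← inl_caseHead (g₁.interp a) (g₂.interp a)]
    exact stoupCut_ctxMap _ _ _
  | disjR₁ f, tensorR g₁ g₂ => by
    rw [scut, interp_castCtx]
    exact (congrArg (fun t => castDom _ _ (stoupCut _ _ t _)) (interp_scut (disjR₁ f) g₁)).trans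
      (stoupCut_assoc _ _ _).symm
  | disjR₁ f, conjR g₁ g₂ => by
    rw [scut]
    exact (congrArg₂ pair (interp_scut (disjR₁ f) g₁) (interp_scut (disjR₁ f) g₂)).trans
      (stoupCut_pair _ _ _).symm
  | disjR₁ f, disjR₁ g => by
    rw [scut]
    exact (congrArg (· ≫ inl _ _) (interp_scut (disjR₁ f) g)).trans (stoupCut_comp _ _ _).symm
  | disjR₁ f, disjR₂ g => by
    rw [scut]
    exact (congrArg (· ≫ inr _ _) (interp_scut (disjR₁ f) g)).trans (stoupCut_comp _ _ _).symm
  | disjR₂ f, ax _ => by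
    rw [scut, interp_castCtx]
    exact (stoupCut_id _).symm
  | disjR₂ f, disjL g₁ g₂ => by
    rw [scut, interp_scut f g₂, ← inr_caseHead (g₁.interp a) (g₂.interp a)]
    exact stoupCut_ctxMap _ _ _
  | disjR₂ f, tensorR g₁ g₂ => by
    rw [scut, interp_castCtx]
    exact (congrArg (fun t => castDom _ _ (stoupCut _ _ t _)) (interp_scut (disjR₂ f) g₁)).trans
      (stoupCut_assoc _ _ _).symm
  | disjR₂ f, conjR g₁ g₂ => by
    rw [scut]
    exact (congrArg₂ pair (interp_scut (disjR₂ f) g₁) (interp_scut (disjR₂ f) g₂)).trans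
      (stoupCut_pair _ _ _).symm
  | disjR₂ f, disjR₁ g => by
    rw [scut]
    exact (congrArg (· ≫ inl _ _) (interp_scut (disjR₂ f) g)).trans (stoupCut_comp _ _ _).symm
  | disjR₂ f, disjR₂ g => by
    rw [scut]
    exact (congrArg (· ≫ inr _ _) (interp_scut (disjR₂ f) g)).trans (stoupCut_comp _ _ _).symm
termination_by (sizeOf A, f.size + g.size)
decreasing_by all_goals simp [Prod.lex_def, size] <;> omega

theorem Deriv.interp_ccut {S : Option (Fma At)} {Γ : List (Fma At)} {A : Fma At}
    {Δ : List (Fma At)} {C : Fma At} (Δ₀ : List (Fma At)) {Δ₁ : List (Fma At)}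
    (f : Deriv none Γ A) (g : Deriv S Δ C) (h : Δ = Δ₀ ++ A :: Δ₁) :
    (ccut Δ₀ f g h).interp a =
      ctxCut (Fma.interp a) Γ (f.interp a) Δ₀ (castDom (Fma.interp a) h (g.interp a)) :=
  match g, h with
  | ax _, h => absurd h (by simp)
  | unitR, h => absurd h (by simp)
  | pass (A := A') (Γ := Γ') g, h => by
    match Δ₀, h with
    | [], h =>
      have ih := interp_scut f (castCtx (List.cons.inj h).2 (castStp (List.cons.inj h).1 g))
      obtain ⟨rfl, rfl⟩ := List.cons.inj h
      rw [ccut]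
      refine ih.trans (.trans ?_ (stoupCut_ctxMap _ _ _).symm)
      exact congrArg (stoupCut _ _ · _) (unitStrength_leftUnitor _).symm
    | B :: Δ₀, h =>
      have ih := interp_ccut Δ₀ f g (List.cons.inj h).2
      obtain ⟨rfl, rfl⟩ := List.cons.inj h
      rw [ccut]
      refine (congrArg (ctxMap _ _ _ ≫ ·) ih).trans ?_
      exact ctxMap_ctxCut _ _ _
  | unitL g, h => by
    rw [ccut]
    exact interp_ccut Δ₀ f g h
  | tensorL (B := B) g, h => by
    have ih := interp_ccut (B :: Δ₀) f g (by rw [h]; rfl)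
    subst h
    rw [ccut]
    exact ih
  | tensorR (Γ := Γ₁) g₁ g₂, h => by
    rw [ccut]
    rcases split Γ₁ Δ₀ h with ⟨Λ, h₁, h₂⟩ | ⟨Λ, h₁, h₂⟩
    · have ih := interp_ccut Δ₀ f g₁ h₁
      subst h₁ h₂
      simp only []
      rw [interp_castCtx, interp, ih, interp]
      exact (ctxCut_stoupCut_left _ _ _).symm
    · have ih := interp_ccut Λ f g₂ h₂
      subst h₁ h₂
      simp only []
      rw [interp_castCtx, interp, ih, interp]
      refine .trans ?_ (ctxCut_stoupCut_right _ _ _).symm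
      rw [ctxCut_unitStrength]
      rfl
  | conjL₁ g, h => by
    have ih := interp_ccut Δ₀ f g h
    subst h
    rw [ccut]
    exact (congrArg (ctxMap _ _ _ ≫ ·) ih).trans (ctxMap_ctxCut _ _ _)
  | conjL₂ g, h => by
    have ih := interp_ccut Δ₀ f g h
    subst h
    rw [ccut]
    exact (congrArg (ctxMap _ _ _ ≫ ·) ih).trans (ctxMap_ctxCut _ _ _)
  | conjR g₁ g₂, h => by
    have ih₁ := interp_ccut Δ₀ f g₁ h
    have ih₂ := interp_ccut Δ₀ f g₂ h
    subst h
    rw [ccut]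
    exact (congrArg₂ pair ih₁ ih₂).trans
      (ctxCut_pair _ _ _).symm
  | disjL g₁ g₂, h => by
    have ih₁ := interp_ccut Δ₀ f g₁ h
    have ih₂ := interp_ccut Δ₀ f g₂ h
    subst h
    rw [ccut]
    exact (congrArg₂ (caseHead _ _) ih₁ ih₂).trans
      (ctxCut_caseHead _ _ _).symm
  | disjR₁ g, h => by
    have ih := interp_ccut Δ₀ f g h
    subst h
    rw [ccut]
    exact (congrArg (· ≫ inl _ _) ih).trans (ctxCut_comp _ _ _).symm
  | disjR₂ g, h => by
    have ih := interp_ccut Δ₀ f g h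
    subst h
    rw [ccut]
    exact (congrArg (· ≫ inr _ _) ih).trans (ctxCut_comp _ _ _).symm
termination_by (sizeOf A, f.size + g.size)
decreasing_by all_goals simp [Prod.lex_def, size, size_castCtx, size_castStp]

end

end Interpretation

end SkewLogic

namespace SkewLogic

/-- The one-premise left rules. -/
inductive LeftRule (At : Type u) : Type u
  | pass (A : Fma At) : LeftRule At
  | unitL : LeftRule At
  | tensorL (A B : Fma At) : LeftRule At
  | conjL₁ (A B : Fma At) : LeftRule At
  | conjL₂ (A B : Fma At) : LeftRule At

/-- The rule leads from the antecedent `S ∣ Γ` of the premise to the antecedent `S' ∣ Γ'` of the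
conclusion. -/
def LeftRule.Applies {At : Type u} (S : Option (Fma At)) (Γ : List (Fma At))
    (S' : Option (Fma At)) (Γ' : List (Fma At)) : LeftRule At → Prop
  | .pass A => S = some A ∧ S' = none ∧ Γ' = A :: Γ
  | .unitL => S = none ∧ S' = some .unit ∧ Γ' = Γ
  | .tensorL A B => S = some A ∧ S' = some (.tensor A B) ∧ Γ = B :: Γ'
  | .conjL₁ A B => S = some A ∧ S' = some (.conj A B) ∧ Γ' = Γ
  | .conjL₂ A B => S = some B ∧ S' = some (.conj A B) ∧ Γ' = Γ

theorem LeftRule.Applies.append {At : Type u} {S S' : Option (Fma At)} {Γ Γ' : List (Fma At)} :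
    {r : LeftRule At} → r.Applies S Γ S' Γ' → (Δ : List (Fma At)) →
      r.Applies S (Γ ++ Δ) S' (Γ' ++ Δ)
  | .pass _, ⟨h₁, h₂, h₃⟩, _ => ⟨h₁, h₂, by rw [h₃]; rfl⟩
  | .unitL, ⟨h₁, h₂, h₃⟩, _ => ⟨h₁, h₂, by rw [h₃]⟩
  | .tensorL _ _, ⟨h₁, h₂, h₃⟩, _ => ⟨h₁, h₂, by rw [h₃]; rfl⟩
  | .conjL₁ _ _, ⟨h₁, h₂, h₃⟩, _ => ⟨h₁, h₂, by rw [h₃]⟩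
  | .conjL₂ _ _, ⟨h₁, h₂, h₃⟩, _ => ⟨h₁, h₂, by rw [h₃]⟩

/-- Families indexed by antecedents on which the left rules act. -/
structure LeftModule (At : Type u) : Type (u + 1) where
  carrier : Option (Fma At) → List (Fma At) → Type u
  step {S S' : Option (Fma At)} {Γ Γ' : List (Fma At)} (r : LeftRule At)
    (h : r.Applies S Γ S' Γ') : carrier S Γ → carrier S' Γ'
  case {A B : Fma At} {Γ : List (Fma At)} :
    carrier (some A) Γ → carrier (some B) Γ → carrier (some (.disj A B)) Γ

namespace LeftModule

variable {At : Type u}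

/-- Families of maps commuting with the left rules. -/
structure Hom (P Q : LeftModule At) : Type u where
  app {S : Option (Fma At)} {Γ : List (Fma At)} : P.carrier S Γ → Q.carrier S Γ
  app_step {S S' : Option (Fma At)} {Γ Γ' : List (Fma At)} (r : LeftRule At)
    (h : r.Applies S Γ S' Γ') (x : P.carrier S Γ) : app (P.step r h x) = Q.step r h (app x)
  app_case {A B : Fma At} {Γ : List (Fma At)} (x : P.carrier (some A) Γ)
    (y : P.carrier (some B) Γ) : app (P.case x y) = Q.case (app x) (app y)

instance : Category.{u} (LeftModule At) where
  Hom := Hom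
  id P := ⟨fun x => x, fun _ _ _ => rfl, fun _ _ => rfl⟩
  comp f g := ⟨fun x => g.app (f.app x), fun r h x => by rw [f.app_step, g.app_step],
    fun x y => by rw [f.app_case, g.app_case]⟩

/-- The action of a morphism on elements. -/
def app {P Q : LeftModule At} (f : P ⟶ Q) {S : Option (Fma At)} {Γ : List (Fma At)}
    (x : P.carrier S Γ) : Q.carrier S Γ :=
  Hom.app f x

section

variable {P Q R M : LeftModule At} {S S' : Option (Fma At)} {Γ Γ' Δ : List (Fma At)}

theorem hom_ext {f g : P ⟶ Q}
    (h : ∀ (S : Option (Fma At)) (Γ : List (Fma At)) (x : P.carrier S Γ), app f x = app g x) :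
    f = g := by
  obtain ⟨f, _, _⟩ := f
  obtain ⟨g, _, _⟩ := g
  have : @f = @g := by
    funext S Γ x
    exact h S Γ x
  subst this
  rfl

theorem app_step (f : P ⟶ Q) (r : LeftRule At) (h : r.Applies S Γ S' Γ') (x : P.carrier S Γ) :
    app f (P.step r h x) = Q.step r h (app f x) :=
  Hom.app_step f r h x

theorem app_case (f : P ⟶ Q) {A B : Fma At} (x : P.carrier (some A) Γ)
    (y : P.carrier (some B) Γ) : app f (P.case x y) = Q.case (app f x) (app f y) :=
  Hom.app_case f x y

/-- Transport along an equality of contexts. -/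
def cast (M : LeftModule At) (e : Γ = Γ') (x : M.carrier S Γ) : M.carrier S Γ' :=
  e ▸ x

theorem cast_cast (e : Γ = Γ') (e' : Γ' = Δ) (x : M.carrier S Γ) :
    M.cast e' (M.cast e x) = M.cast (e.trans e') x := by
  subst e e'; rfl

theorem app_cast (f : P ⟶ Q) (e : Γ = Γ') (x : P.carrier S Γ) :
    app f (P.cast e x) = Q.cast e (app f x) := by
  subst e; rfl

theorem cast_step {Θ Θ' : List (Fma At)} {r : LeftRule At} (h : r.Applies S Γ S' Γ')
    (k : r.Applies S Θ S' Θ') (e : Γ = Θ) (e' : Γ' = Θ') (x : M.carrier S Γ) :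
    M.cast e' (M.step r h x) = M.step r k (M.cast e x) := by
  subst e e'; rfl

theorem cast_case {A B : Fma At} (e : Γ = Γ') (x : M.carrier (some A) Γ)
    (y : M.carrier (some B) Γ) : M.cast e (M.case x y) = M.case (M.cast e x) (M.cast e y) := by
  subst e; rfl

end

/-- The module of elements over extended contexts. -/
def shift (M : LeftModule At) (Δ : List (Fma At)) : LeftModule At where
  carrier S Γ := M.carrier S (Γ ++ Δ)
  step r h x := M.step r (h.append Δ) x
  case x y := M.case x y

/-! ### Universal modules -/

section Glue

variable {J : Type u} (P : J → LeftModule At) (Λ : J → List (Fma At))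

/-- Terms over elements of the modules `P j`, placed in contexts extended by `Λ j`. -/
inductive Pre : Option (Fma At) → List (Fma At) → Type u
  | of {S : Option (Fma At)} {Γ Γ' : List (Fma At)} (j : J) (x : (P j).carrier S Γ)
      (h : Γ' = Γ ++ Λ j) : Pre S Γ'
  | step {S S' : Option (Fma At)} {Γ Γ' : List (Fma At)} (r : LeftRule At)
      (h : r.Applies S Γ S' Γ') (t : Pre S Γ) : Pre S' Γ'
  | case {A B : Fma At} {Γ : List (Fma At)} (t : Pre (some A) Γ) (t' : Pre (some B) Γ) :
      Pre (some (.disj A B)) Γ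

/-- The congruence which makes `Pre.of j` a morphism. -/
inductive Rel : {S : Option (Fma At)} → {Γ : List (Fma At)} → Pre P Λ S Γ → Pre P Λ S Γ → Prop
  | refl {S : Option (Fma At)} {Γ : List (Fma At)} (t : Pre P Λ S Γ) : Rel t t
  | symm {S : Option (Fma At)} {Γ : List (Fma At)} {t t' : Pre P Λ S Γ} : Rel t t' → Rel t' t
  | trans {S : Option (Fma At)} {Γ : List (Fma At)} {t t' t'' : Pre P Λ S Γ} :
      Rel t t' → Rel t' t'' → Rel t t''
  | step {S S' : Option (Fma At)} {Γ Γ' : List (Fma At)} (r : LeftRule At)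
      (h : r.Applies S Γ S' Γ') {t t' : Pre P Λ S Γ} : Rel t t' → Rel (.step r h t) (.step r h t')
  | case {A B : Fma At} {Γ : List (Fma At)} {t t' : Pre P Λ (some A) Γ}
      {s s' : Pre P Λ (some B) Γ} : Rel t t' → Rel s s' → Rel (.case t s) (.case t' s')
  | of_step {S S' : Option (Fma At)} {Γ Γ' : List (Fma At)} (r : LeftRule At)
      (h : r.Applies S Γ S' Γ') (j : J) (x : (P j).carrier S Γ) :
      Rel (.of j ((P j).step r h x) rfl) (.step r (h.append (Λ j)) (.of j x rfl))
  | of_case {A B : Fma At} {Γ : List (Fma At)} (j : J) (x : (P j).carrier (some A) Γ)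
      (y : (P j).carrier (some B) Γ) :
      Rel (.of j ((P j).case x y) rfl) (.case (.of j x rfl) (.of j y rfl))

/-- Terms up to `Rel`. -/
def preSetoid (S : Option (Fma At)) (Γ : List (Fma At)) : Setoid (Pre P Λ S Γ) where
  r := Rel P Λ
  iseqv := ⟨.refl, .symm, .trans⟩

/-- The module `G` such that morphisms `G ⟶ M` are families of morphisms `P j ⟶ M.shift (Λ j)`. -/
def glue : LeftModule At where
  carrier S Γ := Quotient (preSetoid P Λ S Γ)
  step r h := Quotient.map (.step r h) fun _ _ k => .step r h k
  case := Quotient.map₂ .case fun _ _ k _ _ k' => .case k k'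

variable {P Λ}

/-- The generators of `glue P Λ`. -/
def glueOf {S : Option (Fma At)} {Γ Γ' : List (Fma At)} (j : J) (x : (P j).carrier S Γ)
    (h : Γ' = Γ ++ Λ j) : (glue P Λ).carrier S Γ' :=
  Quotient.mk _ (.of j x h)

theorem glueOf_step {S S' : Option (Fma At)} {Γ Γ' Θ Θ' : List (Fma At)} {r : LeftRule At}
    (h : r.Applies S Γ S' Γ') (k : r.Applies S Θ S' Θ') (j : J) (x : (P j).carrier S Γ)
    (e : Θ = Γ ++ Λ j) (e' : Θ' = Γ' ++ Λ j) :
    glueOf j ((P j).step r h x) e' = (glue P Λ).step r k (glueOf j x e) := by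
  subst e e'
  exact Quotient.sound (.of_step r h j x)

theorem glueOf_case {A B : Fma At} {Γ Θ : List (Fma At)} (j : J) (x : (P j).carrier (some A) Γ)
    (y : (P j).carrier (some B) Γ) (e : Θ = Γ ++ Λ j) :
    glueOf j ((P j).case x y) e = (glue P Λ).case (glueOf j x e) (glueOf j y e) := by
  subst e
  exact Quotient.sound (.of_case j x y)

theorem cast_glueOf {S : Option (Fma At)} {Γ Γ' Γ'' : List (Fma At)} (j : J)
    (x : (P j).carrier S Γ) (h : Γ' = Γ ++ Λ j) (e : Γ' = Γ'') :
    (glue P Λ).cast e (glueOf j x h) = glueOf j x (e.symm.trans h) := by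
  subst e; rfl

/-- The extension of a family of morphisms to terms. -/
def preDesc {M : LeftModule At} (φ : ∀ j, P j ⟶ M.shift (Λ j)) :
    {S : Option (Fma At)} → {Γ : List (Fma At)} → Pre P Λ S Γ → M.carrier S Γ
  | _, _, .of j x h => M.cast h.symm (app (φ j) x)
  | _, _, .step r h t => M.step r h (preDesc φ t)
  | _, _, .case t t' => M.case (preDesc φ t) (preDesc φ t')

theorem preDesc_eq {M : LeftModule At} (φ : ∀ j, P j ⟶ M.shift (Λ j))
    {S : Option (Fma At)} {Γ : List (Fma At)} {t t' : Pre P Λ S Γ} (h : Rel P Λ t t') :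
    preDesc φ t = preDesc φ t' := by
  induction h with
  | refl => rfl
  | symm _ ih => exact ih.symm
  | trans _ _ ih ih' => exact ih.trans ih'
  | step r h _ ih => exact congrArg (M.step r h) ih
  | case _ _ ih ih' => exact congrArg₂ M.case ih ih'
  | of_step r h j x => exact app_step (φ j) r h x
  | of_case j x y => exact app_case (φ j) x y

/-- The morphism out of `glue P Λ` given by a family of morphisms. -/
def glueDesc {M : LeftModule At} (φ : ∀ j, P j ⟶ M.shift (Λ j)) : glue P Λ ⟶ M where
  app := Quotient.lift (preDesc φ) fun _ _ h => preDesc_eq φ h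
  app_step _ _ x := Quotient.inductionOn x fun _ => rfl
  app_case x y := Quotient.inductionOn₂ x y fun _ _ => rfl

theorem glue_ext {M : LeftModule At} {f g : glue P Λ ⟶ M}
    (h : ∀ (j : J) (S : Option (Fma At)) (Γ : List (Fma At)) (x : (P j).carrier S Γ),
      app f (glueOf (Λ := Λ) j x rfl) = app g (glueOf j x rfl)) : f = g := by
  refine hom_ext fun S Γ => Quotient.ind fun t => ?_
  induction t with
  | of j x e => subst e; exact h j _ _ x
  | step r k t ih =>
    exact (app_step f r k (Quotient.mk _ t)).trans
      ((congrArg (M.step r k) ih).trans (app_step g r k (Quotient.mk _ t)).symm)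
  | case t t' ih ih' =>
    exact (app_case f (Quotient.mk _ t) (Quotient.mk _ t')).trans
      ((congrArg₂ M.case ih ih').trans (app_case g (Quotient.mk _ t) (Quotient.mk _ t')).symm)

end Glue

/-! ### The unit -/

/-- The elements of the free module on one generator over the empty antecedent. -/
inductive UnitTerm : Option (Fma At) → List (Fma At) → Type u
  | star : UnitTerm none []
  | step {S S' : Option (Fma At)} {Γ Γ' : List (Fma At)} (r : LeftRule At)
      (h : r.Applies S Γ S' Γ') (t : UnitTerm S Γ) : UnitTerm S' Γ'
  | case {A B : Fma At} {Γ : List (Fma At)} (t : UnitTerm (some A) Γ)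
      (t' : UnitTerm (some B) Γ) : UnitTerm (some (.disj A B)) Γ

variable (At) in
/-- The free module on one generator over the empty antecedent. -/
def unit : LeftModule At := ⟨UnitTerm, .step, .case⟩

/-- The generator of the unit. -/
def star : (unit At).carrier none [] := UnitTerm.star

/-- The extension of an element to terms. -/
def unitTermDesc {M : LeftModule At} (m : M.carrier none []) :
    {S : Option (Fma At)} → {Γ : List (Fma At)} → UnitTerm S Γ → M.carrier S Γ
  | _, _, .star => m
  | _, _, .step r h t => M.step r h (unitTermDesc m t)
  | _, _, .case t t' => M.case (unitTermDesc m t) (unitTermDesc m t')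

/-- The morphism out of the unit given by an element. -/
def unitDesc {M : LeftModule At} (m : M.carrier none []) : unit At ⟶ M where
  app := unitTermDesc m
  app_step _ _ _ := rfl
  app_case _ _ := rfl

theorem unit_ext {M : LeftModule At} {f g : unit At ⟶ M} (h : app f star = app g star) :
    f = g := by
  refine hom_ext fun S Γ (t : UnitTerm S Γ) => ?_
  induction t with
  | star => exact h
  | step r k t ih =>
    exact (app_step f r k t).trans ((congrArg (M.step r k) ih).trans (app_step g r k t).symm)
  | case t t' ih ih' =>
    exact (app_case f t t').trans ((congrArg₂ M.case ih ih').trans (app_case g t t').symm)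

/-! ### The tensor product -/

section Tensor

variable {P Q R M : LeftModule At}

/-- The tensor product of modules. -/
def tensor (P Q : LeftModule At) : LeftModule At :=
  glue (J := Σ Δ, Q.carrier none Δ) (fun _ => P) (fun y => y.1)

variable {S S' : Option (Fma At)} {Γ Γ' Δ Δ' Θ Θ' : List (Fma At)}

/-- Pure tensors. -/
def tmul (x : P.carrier S Γ) (y : Q.carrier none Δ) (h : Γ' = Γ ++ Δ) :
    (tensor P Q).carrier S Γ' :=
  glueOf (P := fun _ => P) (Λ := fun y : (Σ Δ, Q.carrier none Δ) => y.1) ⟨Δ, y⟩ x h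

theorem tmul_step {r : LeftRule At} (h : r.Applies S Γ S' Γ') (k : r.Applies S Θ S' Θ')
    (x : P.carrier S Γ) (y : Q.carrier none Δ) (e : Θ = Γ ++ Δ) (e' : Θ' = Γ' ++ Δ) :
    tmul (P.step r h x) y e' = (tensor P Q).step r k (tmul x y e) :=
  glueOf_step (P := fun _ => P) (Λ := fun y : (Σ Δ, Q.carrier none Δ) => y.1) h k ⟨Δ, y⟩ x e e'

theorem tmul_case {A B : Fma At} (x : P.carrier (some A) Γ) (x' : P.carrier (some B) Γ)
    (y : Q.carrier none Δ) (e : Θ = Γ ++ Δ) :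
    tmul (P.case x x') y e = (tensor P Q).case (tmul x y e) (tmul x' y e) :=
  glueOf_case (P := fun _ => P) (Λ := fun y : (Σ Δ, Q.carrier none Δ) => y.1) ⟨Δ, y⟩ x x' e

theorem cast_tmul (x : P.carrier S Γ) (y : Q.carrier none Δ) (h : Γ' = Γ ++ Δ) (e : Γ' = Θ) :
    (tensor P Q).cast e (tmul x y h) = tmul x y (e.symm.trans h) := by
  subst e; rfl

theorem tmul_cast (x : P.carrier S Γ) (y : Q.carrier none Δ) (e : Δ = Δ') (h : Γ' = Γ ++ Δ') :
    tmul x (Q.cast e y) h = tmul x y (h.trans (e ▸ rfl)) := by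
  subst e; rfl

theorem tmul_tmul_congr {Ξ Ξ' : List (Fma At)} (x : P.carrier S Γ) (y : Q.carrier none Δ)
    (z : R.carrier none Δ') (h : Ξ = Δ ++ Δ') (h' : Ξ' = Δ ++ Δ') (k : Θ = Γ ++ Ξ)
    (k' : Θ = Γ ++ Ξ') : tmul x (tmul y z h) k = tmul x (tmul y z h') k' := by
  subst h h'; rfl

/-- Morphisms out of a tensor product. -/
def tensorDesc (φ : ∀ Δ, Q.carrier none Δ → (P ⟶ M.shift Δ)) : tensor P Q ⟶ M :=
  glueDesc fun y => φ y.1 y.2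

/-- Fixing the second argument of a morphism out of a tensor product. -/
def curry (f : tensor P Q ⟶ M) (y : Q.carrier none Δ) : P ⟶ M.shift Δ where
  app x := app f (tmul x y rfl)
  app_step r h x := by rw [tmul_step h (h.append Δ) x y rfl rfl, app_step]; rfl
  app_case x x' := by rw [tmul_case, app_case]; rfl

theorem tensor_ext {f g : tensor P Q ⟶ M}
    (h : ∀ (Δ : List (Fma At)) (y : Q.carrier none Δ), curry f y = curry g y) : f = g :=
  glue_ext fun ⟨Δ, y⟩ _ _ x => congrArg (fun k => app k x) (h Δ y)

/-- The tensor product of morphisms. -/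
def tensorMap {P P' Q Q' : LeftModule At} (f : P ⟶ P') (g : Q ⟶ Q') :
    tensor P Q ⟶ tensor P' Q' :=
  tensorDesc fun Δ y =>
    { app := fun x => tmul (app f x) (app g y) rfl
      app_step := fun r h x => by
        rw [app_step, tmul_step h (h.append Δ) (app f x) (app g y) rfl rfl]; rfl
      app_case := fun x x' => by rw [app_case, tmul_case]; rfl }

theorem tensorMap_tmul {P P' Q Q' : LeftModule At} (f : P ⟶ P') (g : Q ⟶ Q')
    (x : P.carrier S Γ) (y : Q.carrier none Δ) (h : Γ' = Γ ++ Δ) :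
    app (tensorMap f g) (tmul x y h) = tmul (app f x) (app g y) h := by
  subst h; rfl

/-- The left unitor of modules. -/
def lam (P : LeftModule At) : tensor (unit At) P ⟶ P :=
  tensorDesc fun Δ y => unitDesc (M := P.shift Δ) y

/-- The right unitor of modules. -/
def rho (P : LeftModule At) : P ⟶ tensor P (unit At) where
  app x := tmul x star (List.append_nil _).symm
  app_step _ h x := tmul_step h h x star (List.append_nil _).symm (List.append_nil _).symm
  app_case x x' := tmul_case x x' star (List.append_nil _).symm

/-- The associator of modules. -/
def assoc (P Q R : LeftModule At) : tensor (tensor P Q) R ⟶ tensor P (tensor Q R) :=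
  tensorDesc fun Λ z => tensorDesc (M := (tensor P (tensor Q R)).shift Λ) fun Δ y =>
    { app := fun x => tmul x (tmul y z rfl) (List.append_assoc _ _ _)
      app_step := fun _ h x => tmul_step h ((h.append Δ).append Λ) x (tmul y z rfl) _ _
      app_case := fun x x' => tmul_case x x' (tmul y z rfl) _ }

theorem assoc_tmul (x : P.carrier S Γ) (y : Q.carrier none Δ) (z : R.carrier none Δ')
    (h : Γ' = Γ ++ Δ) (h' : Θ = Γ' ++ Δ') :
    app (assoc P Q R) (tmul (tmul x y h) z h') =
      tmul x (tmul y z rfl) (by rw [h', h, List.append_assoc]) := by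
  subst h h'; rfl

end Tensor

/-! ### Products and coproducts -/

/-- The product of modules. -/
def prod (P Q : LeftModule At) : LeftModule At where
  carrier S Γ := P.carrier S Γ × Q.carrier S Γ
  step r h x := (P.step r h x.1, Q.step r h x.2)
  case x y := (P.case x.1 y.1, Q.case x.2 y.2)

/-- The first projection. -/
def fst (P Q : LeftModule At) : prod P Q ⟶ P := ⟨fun x => x.1, fun _ _ _ => rfl, fun _ _ => rfl⟩

/-- The second projection. -/
def snd (P Q : LeftModule At) : prod P Q ⟶ Q := ⟨fun x => x.2, fun _ _ _ => rfl, fun _ _ => rfl⟩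

/-- The pairing of morphisms. -/
def lift {M P Q : LeftModule At} (f : M ⟶ P) (g : M ⟶ Q) : M ⟶ prod P Q where
  app x := (app f x, app g x)
  app_step r h x := by rw [app_step, app_step]; rfl
  app_case x y := by rw [app_case, app_case]; rfl

/-- Elements of `M` as elements over a context extended by nothing. -/
def toShiftNil (M : LeftModule At) : M ⟶ M.shift [] where
  app x := M.cast (List.append_nil _).symm x
  app_step _ h x := cast_step h (h.append []) _ _ x
  app_case x y := cast_case _ x y

section Coproduct

variable {P Q M : LeftModule At}

/-- The coproduct of modules. -/
def coprod (P Q : LeftModule At) : LeftModule At :=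
  glue (J := ULift Bool) (fun j => bif j.down then P else Q) (fun _ => [])

/-- The first injection. -/
def inl (P Q : LeftModule At) : P ⟶ coprod P Q where
  app x := glueOf (P := fun j : ULift Bool => bif j.down then P else Q) ⟨true⟩ x
    (List.append_nil _).symm
  app_step _ h x := glueOf_step (P := fun j : ULift Bool => bif j.down then P else Q)
    (Λ := fun _ => []) h h ⟨true⟩ x _ _
  app_case x y := glueOf_case (P := fun j : ULift Bool => bif j.down then P else Q)
    (Λ := fun _ => []) ⟨true⟩ x y _

/-- The second injection. -/
def inr (P Q : LeftModule At) : Q ⟶ coprod P Q where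
  app x := glueOf (P := fun j : ULift Bool => bif j.down then P else Q) ⟨false⟩ x
    (List.append_nil _).symm
  app_step _ h x := glueOf_step (P := fun j : ULift Bool => bif j.down then P else Q)
    (Λ := fun _ => []) h h ⟨false⟩ x _ _
  app_case x y := glueOf_case (P := fun j : ULift Bool => bif j.down then P else Q)
    (Λ := fun _ => []) ⟨false⟩ x y _

/-- The copairing of morphisms. -/
def desc (f : P ⟶ M) (g : Q ⟶ M) : coprod P Q ⟶ M :=
  glueDesc fun j => match j with
    | ⟨true⟩ => f ≫ toShiftNil M
    | ⟨false⟩ => g ≫ toShiftNil M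

theorem inl_desc (f : P ⟶ M) (g : Q ⟶ M) : inl P Q ≫ desc f g = f :=
  hom_ext fun _ _ x => cast_cast (List.append_nil _).symm (List.append_nil _) (app f x)

theorem inr_desc (f : P ⟶ M) (g : Q ⟶ M) : inr P Q ≫ desc f g = g :=
  hom_ext fun _ _ x => cast_cast (List.append_nil _).symm (List.append_nil _) (app g x)

theorem coprod_ext {f g : coprod P Q ⟶ M} (h₁ : inl P Q ≫ f = inl P Q ≫ g)
    (h₂ : inr P Q ≫ f = inr P Q ≫ g) : f = g := by
  refine glue_ext fun j S Γ x => ?_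
  have key (k : coprod P Q ⟶ M) : app k (glueOf j x rfl) =
      M.cast (List.append_nil Γ).symm (app k (glueOf j x (List.append_nil Γ).symm)) :=
    (congrArg (app k) (cast_glueOf j x _ _).symm).trans (app_cast k _ _)
  refine (key f).trans (.trans (congrArg (M.cast _) ?_) (key g).symm)
  match j with
  | ⟨true⟩ => exact congrArg (fun k => app k x) h₁
  | ⟨false⟩ => exact congrArg (fun k => app k x) h₂

end Coproduct

instance : DistSkewMonoidalStruct (LeftModule At) where
  unit := unit At
  tensorObj := tensor
  tensorHom := tensorMap
  leftUnitor := lam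
  rightUnitor := rho
  associator := assoc
  prod := prod
  fst := fst
  snd := snd
  coprod := coprod
  inl := inl
  inr := inr

theorem isSum_inl_inr (P Q : LeftModule At) : IsSum (inl P Q) (inr P Q) := fun _ f g =>
  ⟨desc f g, ⟨inl_desc f g, inr_desc f g⟩, fun _ h =>
    coprod_ext (h.1.trans (inl_desc f g).symm) (h.2.trans (inr_desc f g).symm)⟩

theorem isSum_tensor (P Q R : LeftModule At) :
    IsSum (tensorMap (inl P Q) (𝟙 R)) (tensorMap (inr P Q) (𝟙 R)) := fun _ f g => by
  refine ⟨tensorDesc fun Δ y => desc (curry f y) (curry g y), ⟨?_, ?_⟩, fun k hk => ?_⟩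
  · exact tensor_ext fun Δ y => inl_desc _ _
  · exact tensor_ext fun Δ y => inr_desc _ _
  · refine tensor_ext fun Δ y => coprod_ext ?_ ?_
    · exact (congrArg (fun k => curry k y) hk.1).trans (inl_desc _ _).symm
    · exact (congrArg (fun k => curry k y) hk.2).trans (inr_desc _ _).symm

instance : DistSkewMonoidalCategory (LeftModule At) where
  tensorHom_id _ _ := tensor_ext fun _ _ => rfl
  tensorHom_comp _ _ _ _ := tensor_ext fun _ _ => rfl
  leftUnitor_naturality _ := tensor_ext fun _ _ => unit_ext rfl
  rightUnitor_naturality f := hom_ext fun _ _ x =>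
    (tensorMap_tmul f (𝟙 _) x star (List.append_nil _).symm).symm
  associator_naturality f g h := tensor_ext fun _ z => tensor_ext fun _ y => hom_ext fun _ _ x =>
    (tensorMap_tmul f (tensorMap g h) x (tmul y z rfl) (List.append_assoc _ _ _)).symm
  unit_unit := unit_ext rfl
  triangle P Q := tensor_ext fun _ y => hom_ext fun _ _ x =>
    (congrArg (app (tensorMap (𝟙 P) (lam Q)))
      (assoc_tmul x star y (List.append_nil _).symm rfl)).trans (tensorMap_tmul _ _ _ _ _)
  associator_leftUnitor _ _ := tensor_ext fun _ _ => tensor_ext fun _ _ => unit_ext rfl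
  rightUnitor_associator _ _ := tensor_ext fun _ y => hom_ext fun _ _ x =>
    (assoc_tmul x y star rfl (List.append_nil _).symm).trans (tmul_tmul_congr _ _ _ _ _ _ _)
  pentagon P Q R T := tensor_ext fun _ t => tensor_ext fun _ z => tensor_ext fun _ y =>
    hom_ext fun _ _ x =>
      (congrArg (app (tensorMap (𝟙 P) (assoc Q R T)))
        (assoc_tmul x (tmul y z rfl) t (List.append_assoc _ _ _) rfl)).trans
        ((tensorMap_tmul _ _ _ _ _).trans ((congrArg (tmul x · _) (assoc_tmul y z t rfl rfl)).trans
        ((tmul_tmul_congr _ _ _ _ _ _ _).trans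
          (assoc_tmul x y (tmul z t rfl) rfl (List.append_assoc _ _ _)).symm)))
  prod_isLimit _ _ := ⟨BinaryFan.IsLimit.mk _ (fun f g => lift f g) (fun _ _ => rfl)
    (fun _ _ => rfl) (fun _ _ _ h₁ h₂ => hom_ext fun _ _ x =>
      Prod.ext (congrArg (fun k => app k x) h₁) (congrArg (fun k => app k x) h₂))⟩
  coprod_isColimit P Q := (isSum_inl_inr P Q).nonempty_isColimit
  distrib P Q R := (isSum_tensor P Q R).isIso_desc _

end LeftModule

end SkewLogic

namespace SkewLogic

variable {At : Type u}

namespace Deriv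

/-- The action of the one-premise left rules on derivations. -/
def leftStep {S S' : Option (Fma At)} {Γ Γ' : List (Fma At)} {C : Fma At} (r : LeftRule At)
    (h : r.Applies S Γ S' Γ') (f : Deriv S Γ C) : Deriv S' Γ' C :=
  match r, h with
  | .pass _, h => by
    have h₁ := h.1
    have h₂ := h.2.1
    have h₃ := h.2.2
    subst h₁ h₂ h₃
    exact f.pass
  | .unitL, h => by
    have h₁ := h.1
    have h₂ := h.2.1
    have h₃ := h.2.2
    subst h₁ h₂ h₃
    exact f.unitL
  | .tensorL _ _, h => by
    have h₁ := h.1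
    have h₂ := h.2.1
    have h₃ := h.2.2
    subst h₁ h₂ h₃
    exact f.tensorL
  | .conjL₁ _ _, h => by
    have h₁ := h.1
    have h₂ := h.2.1
    have h₃ := h.2.2
    subst h₁ h₂ h₃
    exact f.conjL₁
  | .conjL₂ _ _, h => by
    have h₁ := h.1
    have h₂ := h.2.1
    have h₃ := h.2.2
    subst h₁ h₂ h₃
    exact f.conjL₂

section

variable {S S' : Option (Fma At)} {Γ Γ' Δ : List (Fma At)} {A B C : Fma At}

theorem Eqv.leftStep (r : LeftRule At) (h : r.Applies S Γ S' Γ') {f f' : Deriv S Γ C}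
    (k : f.Eqv f') : (f.leftStep r h).Eqv (f'.leftStep r h) := by
  cases r <;> obtain ⟨rfl, rfl, rfl⟩ := h
  exacts [k.pass, k.unitL, k.tensorL, k.conjL₁, k.conjL₂]

theorem Eqv.tensorR_leftStep (r : LeftRule At) (h : r.Applies S Γ S' Γ') (f : Deriv S Γ A)
    (g : Deriv none Δ B) :
    ((f.leftStep r h).tensorR g).Eqv ((f.tensorR g).leftStep r (h.append Δ)) := by
  cases r <;> obtain ⟨rfl, rfl, rfl⟩ := h
  exacts [.tensorR_pass f g, .tensorR_unitL f g, .tensorR_tensorL f g, .tensorR_conjL₁ f g,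
    .tensorR_conjL₂ f g]

theorem Eqv.conjR_leftStep (r : LeftRule At) (h : r.Applies S Γ S' Γ') (f : Deriv S Γ A)
    (g : Deriv S Γ B) :
    ((f.leftStep r h).conjR (g.leftStep r h)).Eqv ((f.conjR g).leftStep r h) := by
  cases r <;> obtain ⟨rfl, rfl, rfl⟩ := h
  exacts [(Eqv.pass_conjR f g).symm, (Eqv.unitL_conjR f g).symm, (Eqv.tensorL_conjR f g).symm,
    (Eqv.conjL₁_conjR f g).symm, (Eqv.conjL₂_conjR f g).symm]

theorem Eqv.disjR₁_leftStep (r : LeftRule At) (h : r.Applies S Γ S' Γ') (f : Deriv S Γ A) :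
    ((f.leftStep r h).disjR₁ (B := B)).Eqv (f.disjR₁.leftStep r h) := by
  cases r <;> obtain ⟨rfl, rfl, rfl⟩ := h
  exacts [.disjR₁_pass f, .disjR₁_unitL f, .disjR₁_tensorL f, .disjR₁_conjL₁ f, .disjR₁_conjL₂ f]

theorem Eqv.disjR₂_leftStep (r : LeftRule At) (h : r.Applies S Γ S' Γ') (f : Deriv S Γ B) :
    ((f.leftStep r h).disjR₂ (A := A)).Eqv (f.disjR₂.leftStep r h) := by
  cases r <;> obtain ⟨rfl, rfl, rfl⟩ := h
  exacts [.disjR₂_pass f, .disjR₂_unitL f, .disjR₂_tensorL f, .disjR₂_conjL₁ f, .disjR₂_conjL₂ f]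

end

end Deriv

theorem mk_eq_mk {S : Option (Fma At)} {Γ : List (Fma At)} {A : Fma At} {f g : Deriv S Γ A}
    (h : f.Eqv g) : Quotient.mk (Deriv.setoid S Γ A) f = Quotient.mk (Deriv.setoid S Γ A) g :=
  Quotient.sound h

open LeftModule

/-- The module of derivations of a formula up to `≗`. -/
def derivModule (C : Fma At) : LeftModule At where
  carrier S Γ := Quotient (Deriv.setoid S Γ C)
  step r h := Quotient.map (Deriv.leftStep r h) fun _ _ k => k.leftStep r h
  case := Quotient.map₂ .disjL fun _ _ k _ _ k' => .disjL k k'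

/-- The interpretation of atoms by their derivations. -/
def atomModule (X : At) : LeftModule At := derivModule (.atom X)

/-- The interpretation of formulae by modules. -/
abbrev fmaModule : Fma At → LeftModule At := Fma.interp atomModule

/-- Tensoring with a derivation on the right. -/
def tensorRHom (A : Fma At) {B : Fma At} {Δ : List (Fma At)}
    (g : (derivModule B).carrier none Δ) :
    derivModule A ⟶ (derivModule (.tensor A B)).shift Δ where
  app f := Quotient.map₂ .tensorR (fun _ _ k _ _ k' => .tensorR k k') f g
  app_step r h f := Quotient.inductionOn₂ f g fun f g =>
    mk_eq_mk (Deriv.Eqv.tensorR_leftStep r h f g)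
  app_case f₁ f₂ := Quotient.inductionOn₃ f₁ f₂ g fun f₁ f₂ g =>
    mk_eq_mk (Deriv.Eqv.tensorR_disjL f₁ f₂ g)

/-- The tensor rule as a morphism of modules. -/
def tensorRModule (A B : Fma At) :
    tensor (derivModule A) (derivModule B) ⟶ derivModule (.tensor A B) :=
  tensorDesc fun _ g => tensorRHom A g

/-- The conjunction rule as a morphism of modules. -/
def conjRModule (A B : Fma At) :
    LeftModule.prod (derivModule A) (derivModule B) ⟶ derivModule (.conj A B) where
  app f := Quotient.map₂ .conjR (fun _ _ k _ _ k' => .conjR k k') f.1 f.2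
  app_step r h := fun ⟨f, g⟩ => Quotient.inductionOn₂ f g fun f g =>
    mk_eq_mk (Deriv.Eqv.conjR_leftStep r h f g)
  app_case := fun ⟨f₁, f₂⟩ ⟨g₁, g₂⟩ => Quotient.inductionOn₂ f₁ f₂ fun f₁ f₂ =>
    Quotient.inductionOn₂ g₁ g₂ fun g₁ g₂ => mk_eq_mk (Deriv.Eqv.disjL_conjR f₁ g₁ f₂ g₂).symm

/-- The first disjunction rule as a morphism of modules. -/
def disjR₁Module (A B : Fma At) : derivModule A ⟶ derivModule (.disj A B) where
  app := Quotient.map .disjR₁ fun _ _ k => .disjR₁ k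
  app_step r h := Quotient.ind fun f => mk_eq_mk (Deriv.Eqv.disjR₁_leftStep r h f)
  app_case f g := Quotient.inductionOn₂ f g fun f g => mk_eq_mk (Deriv.Eqv.disjR₁_disjL f g)

/-- The second disjunction rule as a morphism of modules. -/
def disjR₂Module (A B : Fma At) : derivModule B ⟶ derivModule (.disj A B) where
  app := Quotient.map .disjR₂ fun _ _ k => .disjR₂ k
  app_step r h := Quotient.ind fun f => mk_eq_mk (Deriv.Eqv.disjR₂_leftStep r h f)
  app_case f g := Quotient.inductionOn₂ f g fun f g => mk_eq_mk (Deriv.Eqv.disjR₂_disjL f g)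

/-- Reading back derivations from the interpretation of a formula. -/
def reify : (A : Fma At) → (fmaModule A ⟶ derivModule A)
  | .atom X => 𝟙 (derivModule (.atom X))
  | .unit => unitDesc (M := derivModule .unit) (Quotient.mk _ .unitR)
  | .tensor A B => tensorMap (reify A) (reify B) ≫ tensorRModule A B
  | .conj A B =>
      LeftModule.lift (LeftModule.fst _ _ ≫ reify A) (LeftModule.snd _ _ ≫ reify B) ≫
        conjRModule A B
  | .disj A B => LeftModule.desc (reify A ≫ disjR₁Module A B) (reify B ≫ disjR₂Module A B)

/-- The generic element of the interpretation of a formula. -/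
def generic : (A : Fma At) → (fmaModule A).carrier (some A) []
  | .atom X => Quotient.mk _ (.ax (.atom X))
  | .unit => (LeftModule.unit At).step .unitL ⟨rfl, rfl, rfl⟩ star
  | .tensor A B =>
      (tensor (fmaModule A) (fmaModule B)).step (.tensorL A B) ⟨rfl, rfl, rfl⟩
        (tmul (generic A)
          ((fmaModule B).step (.pass B) ⟨rfl, rfl, rfl⟩ (generic B)) (List.nil_append [B]).symm)
  | .conj A B => ((fmaModule A).step (.conjL₁ A B) ⟨rfl, rfl, rfl⟩ (generic A),
      (fmaModule B).step (.conjL₂ A B) ⟨rfl, rfl, rfl⟩ (generic B))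
  | .disj A B => (LeftModule.coprod (fmaModule A) (fmaModule B)).case
      (app (LeftModule.inl _ _) (generic A)) (app (LeftModule.inr _ _) (generic B))

/-- The generic element, moved out of the stoup. -/
def passGeneric (A : Fma At) : (fmaModule A).carrier none [A] :=
  (fmaModule A).step (.pass A) ⟨rfl, rfl, rfl⟩ (generic A)

theorem reify_passGeneric {A : Fma At}
    (h : app (reify A) (generic A) = Quotient.mk (Deriv.setoid _ _ _) (.ax A)) :
    app (reify A) (passGeneric A) = Quotient.mk (Deriv.setoid none [A] A) (.pass (.ax A)) :=
  (app_step (reify A) _ _ _).trans (congrArg ((derivModule A).step (.pass A) ⟨rfl, rfl, rfl⟩) h)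

theorem reify_tmul {A B : Fma At} {S : Option (Fma At)} {Γ Δ : List (Fma At)}
    (x : (fmaModule A).carrier S Γ) (y : (fmaModule B).carrier none Δ) :
    app (reify (.tensor A B)) (tmul x y rfl) =
      Quotient.map₂ (sc := Deriv.setoid _ _ _) .tensorR (fun _ _ k _ _ k' => .tensorR k k')
        (app (reify A) x) (app (reify B) y) := rfl

theorem reify_generic (A : Fma At) :
    app (reify A) (generic A) = Quotient.mk (Deriv.setoid _ _ _) (.ax A) := by
  induction A with
  | atom X => rfl
  | unit => exact mk_eq_mk Deriv.Eqv.ax_unit.symm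
  | tensor A B ihA ihB =>
    refine .trans ?_ (mk_eq_mk (Deriv.Eqv.ax_tensor A B).symm)
    refine (app_step (reify (.tensor A B)) (.tensorL A B) ⟨rfl, rfl, rfl⟩
      (tmul (generic A) (passGeneric B) (List.nil_append [B]).symm)).trans ?_
    refine congrArg ((derivModule (.tensor A B)).step (.tensorL A B) ⟨rfl, rfl, rfl⟩)
      ((reify_tmul (generic A) (passGeneric B)).trans
        (?_ : _ = Quotient.mk (Deriv.setoid (some A) [B] _) (.tensorR (.ax A) (.pass (.ax B)))))
    rw [ihA, reify_passGeneric ihB]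
    rfl
  | conj A B ihA ihB =>
    refine .trans ?_ (mk_eq_mk (Deriv.Eqv.ax_conj A B).symm)
    have h₁ : app (reify A) ((fmaModule A).step (.conjL₁ A B) ⟨rfl, rfl, rfl⟩ (generic A)) =
        Quotient.mk (Deriv.setoid (some (.conj A B)) [] A) (.conjL₁ (.ax A)) :=
      (app_step _ _ _ _).trans (congrArg ((derivModule A).step (.conjL₁ A B) ⟨rfl, rfl, rfl⟩) ihA)
    have h₂ : app (reify B) ((fmaModule B).step (.conjL₂ A B) ⟨rfl, rfl, rfl⟩ (generic B)) =
        Quotient.mk (Deriv.setoid (some (.conj A B)) [] B) (.conjL₂ (.ax B)) :=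
      (app_step _ _ _ _).trans (congrArg ((derivModule B).step (.conjL₂ A B) ⟨rfl, rfl, rfl⟩) ihB)
    exact congrArg₂ (fun x y => app (conjRModule A B) (x, y)) h₁ h₂
  | disj A B ihA ihB =>
    refine .trans ?_ (mk_eq_mk (Deriv.Eqv.ax_disj A B).symm)
    refine (app_case (reify (.disj A B)) _ _).trans ?_
    refine congrArg₂ (derivModule (.disj A B)).case
      (?_ : _ = Quotient.mk (Deriv.setoid _ _ _) _) (?_ : _ = Quotient.mk (Deriv.setoid _ _ _) _)
    · exact (congrArg (fun k => app k (generic A))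
        (inl_desc (reify A ≫ disjR₁Module A B) (reify B ≫ disjR₂Module A B))).trans
        (congrArg (app (disjR₁Module A B)) ihA)
    · exact (congrArg (fun k => app k (generic B))
        (inr_desc (reify A ≫ disjR₁Module A B) (reify B ≫ disjR₂Module A B))).trans
        (congrArg (app (disjR₂Module A B)) ihB)

section Fill

variable {X Y : LeftModule At} {S S' : Option (Fma At)} {Γ₀ Γ Γ' Δ Δ₀ Θ Θ' : List (Fma At)}

/-- Extending an element of the head of a context by generic elements. -/
def fill {Γ₀ Γ' : List (Fma At)} : {X : LeftModule At} → X.carrier S Γ₀ → (Γ : List (Fma At)) →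
    Γ' = Γ₀ ++ Γ → (ctx fmaModule X Γ).carrier S Γ'
  | X, x, [], h => X.cast (by rw [h, List.append_nil]) x
  | X, x, A :: Γ, h =>
      fill (X := tensor X (fmaModule A)) (tmul x (passGeneric A) rfl) Γ
        (by rw [h, List.append_assoc]; rfl)

theorem fill_cast (x : X.carrier S Γ₀) (e : Γ₀ = Δ₀) (h : Γ' = Δ₀ ++ Γ) :
    fill (X.cast e x) Γ h = fill x Γ (h.trans (e ▸ rfl)) := by
  subst e; rfl

theorem ctxMap_fill (f : X ⟶ Y) (x : X.carrier S Γ₀) (h : Γ' = Γ₀ ++ Γ) :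
    app (ctxMap fmaModule f Γ) (fill x Γ h) = fill (app f x) Γ h := by
  induction Γ generalizing X Y Γ₀ with
  | nil => exact app_cast f _ x
  | cons A Γ ih =>
    refine (ih (tensorMap f (𝟙 (fmaModule A))) (tmul x (passGeneric A) rfl) _).trans ?_
    exact congrArg (fill · Γ _) (tensorMap_tmul f (𝟙 _) x (passGeneric A) rfl)

theorem fill_step {r : LeftRule At} (k : r.Applies S Γ₀ S' Δ₀) (k' : r.Applies S Θ S' Θ')
    (x : X.carrier S Γ₀) (h : Θ = Γ₀ ++ Γ) (h' : Θ' = Δ₀ ++ Γ) :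
    fill (X.step r k x) Γ h' = (ctx fmaModule X Γ).step r k' (fill x Γ h) := by
  induction Γ generalizing X Γ₀ Δ₀ with
  | nil => exact cast_step k k' _ _ x
  | cons A Γ ih =>
    refine .trans ?_ (ih (k.append [A]) (tmul x (passGeneric A) rfl) _
      (by rw [h', List.append_assoc]; rfl))
    exact congrArg (fill · Γ _) (tmul_step k (k.append [A]) x (passGeneric A) rfl rfl)

theorem fill_case {A B : Fma At} (x : X.carrier (some A) Γ₀) (y : X.carrier (some B) Γ₀)
    (h : Θ = Γ₀ ++ Γ) :
    fill (X.case x y) Γ h = (ctx fmaModule X Γ).case (fill x Γ h) (fill y Γ h) := by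
  induction Γ generalizing X Γ₀ with
  | nil => exact cast_case _ x y
  | cons D Γ ih =>
    refine .trans ?_ (ih (tmul x (passGeneric D) rfl) (tmul y (passGeneric D) rfl) _)
    exact congrArg (fill · Γ _) (tmul_case x y (passGeneric D) rfl)

theorem stoupCut_fill {Z : LeftModule At} (f : ctx fmaModule X Γ ⟶ Y)
    (g : ctx fmaModule Y Δ ⟶ Z) (x : X.carrier S Γ₀) (h : Γ' = Γ₀ ++ Γ) (h' : Θ = Γ' ++ Δ) :
    app (stoupCut fmaModule Γ f g) (fill x (Γ ++ Δ) (by rw [h', h, List.append_assoc])) =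
      app g (fill (app f (fill x Γ h)) Δ h') := by
  induction Γ generalizing X Γ₀ with
  | nil =>
    refine congrArg (app g) ((ctxMap_fill f x _).trans ?_)
    exact .trans (fill_cast _ _ _).symm (congrArg (fill · Δ _) (app_cast f _ x).symm)
  | cons A Γ ih => exact ih f (tmul x (passGeneric A) rfl) _

theorem assocCtx_fill (x : X.carrier S Γ₀) (y : Y.carrier none Δ₀) (h : Θ = Γ₀ ++ Δ₀)
    (h' : Θ' = Δ₀ ++ Γ) (k : Γ' = Γ₀ ++ Θ') :
    app (assocCtx fmaModule X Y Γ) (fill (X := tensor X Y) (tmul x y h) Γ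
      (by rw [k, h, h', List.append_assoc])) = tmul x (fill y Γ h') k := by
  induction Γ generalizing Y Δ₀ Θ with
  | nil => exact (cast_tmul _ _ _ _).trans (tmul_cast _ _ _ _).symm
  | cons A Γ ih =>
    refine .trans (congrArg (app (assocCtx fmaModule X (tensor Y (fmaModule A)) Γ)) ?_)
      (ih (tmul y (passGeneric A) rfl) (Θ := Γ₀ ++ (Δ₀ ++ [A])) rfl _)
    subst h
    refine (ctxMap_fill (assoc X Y (fmaModule A)) _ _).trans ?_
    refine (congrArg (fill · Γ _) (assoc_tmul x y (passGeneric A) rfl rfl)).trans ?_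
    refine .trans (congrArg (fill · Γ _)
      (cast_tmul x (tmul y (passGeneric A) rfl) rfl (List.append_assoc _ _ _).symm).symm) ?_
    exact fill_cast _ _ _

theorem unitStrength_fill (g : ctx fmaModule (LeftModule.unit At) Γ ⟶ Y) (x : X.carrier S Γ₀)
    (h : Γ' = Γ₀ ++ Γ) :
    app (unitStrength fmaModule X Γ g) (fill x Γ h) =
      tmul x (app g (fill star Γ (List.nil_append Γ).symm)) h := by
  refine (congrArg (app (strength fmaModule X Γ g)) (ctxMap_fill (rho X) x h)).trans ?_
  refine (congrArg (app (tensorMap (𝟙 X) g)) (assocCtx_fill x star (List.append_nil _).symm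
    (List.nil_append Γ).symm h)).trans ?_
  exact tensorMap_tmul _ _ _ _ _

end Fill

/-- The generic element of the interpretation of an antecedent. -/
def genericCtx : (S : Option (Fma At)) → (Γ : List (Fma At)) →
    (ctx fmaModule (stoupInterp atomModule S) Γ).carrier S Γ
  | none, Γ => fill (X := LeftModule.unit At) star Γ (List.nil_append Γ).symm
  | some A, Γ => fill (generic A) Γ (List.nil_append Γ).symm

theorem genericCtx_append (S : Option (Fma At)) {Γ Δ : List (Fma At)} {Y Z : LeftModule At}
    (f : ctx fmaModule (stoupInterp atomModule S) Γ ⟶ Y) (g : ctx fmaModule Y Δ ⟶ Z) :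
    app (stoupCut fmaModule Γ f g) (genericCtx S (Γ ++ Δ)) =
      app g (fill (app f (genericCtx S Γ)) Δ rfl) := by
  cases S with
  | none => exact stoupCut_fill f g star (List.nil_append Γ).symm rfl
  | some A => exact stoupCut_fill f g (generic A) (List.nil_append Γ).symm rfl

theorem reify_of_eq_step {S : Option (Fma At)} {Γ Γ' : List (Fma At)} {A : Fma At}
    {P : LeftModule At} {k : P ⟶ fmaModule A} {x : P.carrier S Γ} {f : Deriv S Γ A}
    (ih : app (reify A) (app k x) = Quotient.mk (Deriv.setoid S Γ A) f) {S' : Option (Fma At)}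
    {r : LeftRule At} {h : r.Applies S Γ S' Γ'} {y : P.carrier S' Γ'} (hy : y = P.step r h x) :
    app (reify A) (app k y) = Quotient.mk (Deriv.setoid S' Γ' A) (f.leftStep r h) := by
  rw [hy, app_step, app_step, ih]
  rfl

theorem reify_interp {S : Option (Fma At)} {Γ : List (Fma At)} {A : Fma At} (f : Deriv S Γ A) :
    app (reify A) (app (f.interp atomModule) (genericCtx S Γ)) =
      Quotient.mk (Deriv.setoid S Γ A) f := by
  induction f with
  | ax A => exact reify_generic A
  | @pass A Γ C f ih =>
    refine reify_of_eq_step (r := .pass A) (h := ⟨rfl, rfl, rfl⟩) ih ?_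
    refine (ctxMap_fill (lam (fmaModule A)) _ _).trans ?_
    exact fill_step (r := .pass A) ⟨rfl, rfl, rfl⟩ ⟨rfl, rfl, rfl⟩ (generic A) _ _
  | @unitL Γ C f ih =>
    refine reify_of_eq_step (r := .unitL) (h := ⟨rfl, rfl, rfl⟩) ih ?_
    exact fill_step (r := .unitL) ⟨rfl, rfl, rfl⟩ ⟨rfl, rfl, rfl⟩ star _ _
  | unitR => rfl
  | @tensorL A B Γ C f ih =>
    refine reify_of_eq_step (r := .tensorL A B) (h := ⟨rfl, rfl, rfl⟩) ih ?_
    exact fill_step (r := .tensorL A B) ⟨rfl, rfl, rfl⟩ ⟨rfl, rfl, rfl⟩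
      (tmul (generic A) (passGeneric B) rfl) _ _
  | @tensorR S Γ Δ A B f g ihf ihg =>
    refine (congrArg (app (reify (.tensor A B))) ((genericCtx_append S _ _).trans
      (unitStrength_fill (g.interp atomModule) _ rfl))).trans ?_
    refine (reify_tmul _ _).trans ?_
    refine (congrArg₂ (Quotient.map₂ _ _) ihf ihg).trans ?_
    rfl
  | @conjL₁ A B Γ C f ih =>
    refine reify_of_eq_step (r := .conjL₁ A B) (h := ⟨rfl, rfl, rfl⟩) ih ?_
    refine (ctxMap_fill (LeftModule.fst (fmaModule A) (fmaModule B)) _ _).trans ?_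
    exact fill_step (r := .conjL₁ A B) ⟨rfl, rfl, rfl⟩ ⟨rfl, rfl, rfl⟩ (generic A) _ _
  | @conjL₂ A B Γ C f ih =>
    refine reify_of_eq_step (r := .conjL₂ A B) (h := ⟨rfl, rfl, rfl⟩) ih ?_
    refine (ctxMap_fill (LeftModule.snd (fmaModule A) (fmaModule B)) _ _).trans ?_
    exact fill_step (r := .conjL₂ A B) ⟨rfl, rfl, rfl⟩ ⟨rfl, rfl, rfl⟩ (generic B) _ _
  | @conjR S Γ A B f g ihf ihg =>
    refine .trans ?_ (congrArg₂ (fun x y => app (conjRModule A B) (x, y)) ihf ihg)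
    refine congrArg₂ (fun x y => app (conjRModule A B) (app (reify A) x, app (reify B) y))
      (congrArg (fun k => app k (genericCtx S Γ)) (pair_fst _ _))
      (congrArg (fun k => app k (genericCtx S Γ)) (pair_snd _ _))
  | @disjL A B Γ C f g ihf ihg =>
    refine .trans ?_ (congrArg₂ (derivModule C).case ihf ihg)
    refine (congrArg (fun x => app (reify C)
      (app (caseHead fmaModule Γ (f.interp atomModule) (g.interp atomModule)) x))
      (fill_case (app (LeftModule.inl _ _) (generic A)) (app (LeftModule.inr _ _) (generic B))
        _)).trans ?_
    refine ((congrArg (app (reify C)) (app_case (caseHead fmaModule Γ _ _) _ _)).trans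
      (app_case (reify C) _ _)).trans ?_
    refine congrArg₂ (fun x y => (derivModule C).case (app (reify C) x) (app (reify C) y)) ?_ ?_
    · refine .trans ?_ (congrArg (fun k => app k (genericCtx (some A) Γ)) (inl_caseHead (f.interp atomModule) (g.interp atomModule)))
      exact congrArg (app (caseHead _ _ _ _)) (ctxMap_fill _ _ _).symm
    · refine .trans ?_ (congrArg (fun k => app k (genericCtx (some B) Γ)) (inr_caseHead (f.interp atomModule) (g.interp atomModule)))
      exact congrArg (app (caseHead _ _ _ _)) (ctxMap_fill _ _ _).symm
  | @disjR₁ S Γ A B f ih =>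
    refine .trans ?_ (congrArg (app (disjR₁Module A B)) ih)
    exact congrArg (fun k => app k (app (f.interp atomModule) (genericCtx S Γ)))
      (inl_desc (reify A ≫ disjR₁Module A B) (reify B ≫ disjR₂Module A B))
  | @disjR₂ S Γ A B f ih =>
    refine .trans ?_ (congrArg (app (disjR₂Module A B)) ih)
    exact congrArg (fun k => app k (app (f.interp atomModule) (genericCtx S Γ)))
      (inr_desc (reify A ≫ disjR₁Module A B) (reify B ≫ disjR₂Module A B))

theorem Deriv.eqv_of_interp_eq {S : Option (Fma At)} {Γ : List (Fma At)} {A : Fma At}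
    {f g : Deriv S Γ A} (h : f.interp atomModule = g.interp atomModule) : f.Eqv g :=
  Quotient.exact (s := Deriv.setoid S Γ A)
    ((reify_interp f).symm.trans 
      ((congrArg (fun k => app (reify A) (app k (genericCtx S Γ))) h).trans (reify_interp g)))

end SkewLogic

namespace SkewLogic

namespace FDSkM

theorem categoryLaws (At : Type u) : CategoryLaws At where
  scut_congr {_ _ _} {f f' g g'} h h' := Deriv.eqv_of_interp_eq <|
    ((f.interp_scut _ g).trans
      (congrArg₂ (stoupCut _ []) (h.interp_eq _) (h'.interp_eq _))).trans
        (f'.interp_scut _ g').symm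
  ax_scut f := Deriv.eqv_of_interp_eq <| ((Deriv.ax _).interp_scut _ f).trans (Category.id_comp _)
  scut_ax f := Deriv.eqv_of_interp_eq <| (f.interp_scut _ (.ax _)).trans (Category.comp_id _)
  scut_assoc f g h := Deriv.eqv_of_interp_eq <|
    (((f.scut g).interp_scut _ h).trans (congrArg (· ≫ _) (f.interp_scut _ g))).trans <|
      (Category.assoc _ _ _).trans <|
        ((f.interp_scut _ (g.scut h)).trans (congrArg (_ ≫ ·) (g.interp_scut _ h))).symm

variable {At : Type u}

instance : Category.{u} (FDSkM At) := category (categoryLaws At)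

instance : DistSkewMonoidalStruct (FDSkM At) := struct (categoryLaws At)

open DistSkewMonoidalStruct

section InterpFunctor

variable {D : Type w} [Category.{v} D] [DistSkewMonoidalStruct D] [DistSkewMonoidalCategory D]
  (a : At → D)

/-- The functor from the syntactic category given by an interpretation of the atoms. -/
noncomputable def interpFunctor : FDSkM At ⥤ D where
  obj A := A.interp a
  map := Quotient.lift (fun f => f.interp a) fun _ _ h => h.interp_eq a
  map_id _ := rfl
  map_comp f g := Quotient.inductionOn₂ f g fun f g => f.interp_scut a g

theorem interpFunctor_map_tensorHom {A A' B B' : FDSkM At} (f : A ⟶ A') (g : B ⟶ B') :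
    (interpFunctor a).map (tensorHom f g) =
      tensorHom ((interpFunctor a).map f) ((interpFunctor a).map g) := by
  refine Quotient.inductionOn₂ f g fun f g => ?_
  refine (congrArg (_ ≫ ·) ((unitStrength_comp (Γ := [B]) (A'.interp a) (leftUnitor (B.interp a))
    (g.interp a)).trans (congrArg (· ≫ _) (unitStrength_singleton (Fma.interp a) _ B)))).trans ?_
  refine (congrArg (_ ≫ ·) (Category.id_comp _)).trans ?_
  refine (DistSkewMonoidalCategory.tensorHom_comp _ _ _ _).symm.trans ?_
  exact congrArg₂ tensorHom (Category.comp_id _) (Category.id_comp _)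

theorem interpFunctor_map_leftUnitor (A : FDSkM At) :
    (interpFunctor a).map (leftUnitor A) = leftUnitor ((interpFunctor a).obj A) :=
  Category.comp_id _

theorem interpFunctor_map_rightUnitor (A : FDSkM At) :
    (interpFunctor a).map (rightUnitor A) = rightUnitor ((interpFunctor a).obj A) :=
  (Category.id_comp _).trans <| (congrArg (_ ≫ ·) ((Category.id_comp _).trans
    (DistSkewMonoidalCategory.tensorHom_id _ _))).trans (Category.comp_id _)

theorem interpFunctor_map_associator (A B C : FDSkM At) :
    (interpFunctor a).map (associator A B C) =
      associator ((interpFunctor a).obj A) ((interpFunctor a).obj B) ((interpFunctor a).obj C) := by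
  have h : (Deriv.tensorR (.ax B) (.pass (.ax C))).interp a = 𝟙 _ :=
    (Deriv.Eqv.ax_tensor B C).symm.interp_eq a
  refine (id_stoupCut _).trans ?_
  refine (congrArg (fun k => unitStrength (Fma.interp a) (A.interp a) [B, C]
    (ctxMap (Fma.interp a) (leftUnitor (B.interp a)) [C] ≫ k)) h).trans ?_
  refine (unitStrength_stoupCut (Γ := [B]) (Δ := [C]) (A.interp a)
    (leftUnitor (B.interp a)) (𝟙 (tensorObj (B.interp a) (C.interp a)))).trans ?_
  refine (congrArg (fun k => stoupCut (Fma.interp a) [B] k _)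
    (unitStrength_singleton (Fma.interp a) (A.interp a) B)).trans ?_
  refine (id_stoupCut (o := Fma.interp a) (Δ := [C]) _).trans ?_
  refine (congrArg (_ ≫ ·) (DistSkewMonoidalCategory.tensorHom_id _ _)).trans ?_
  exact (Category.comp_id _).trans (Category.comp_id _)

theorem interpFunctor_map_fst (A B : FDSkM At) :
    (interpFunctor a).map (fst A B) = fst ((interpFunctor a).obj A) ((interpFunctor a).obj B) :=
  Category.comp_id _

theorem interpFunctor_map_snd (A B : FDSkM At) :
    (interpFunctor a).map (snd A B) = snd ((interpFunctor a).obj A) ((interpFunctor a).obj B) :=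
  Category.comp_id _

theorem interpFunctor_map_inl (A B : FDSkM At) :
    (interpFunctor a).map (inl A B) = inl ((interpFunctor a).obj A) ((interpFunctor a).obj B) :=
  Category.id_comp _

theorem interpFunctor_map_inr (A B : FDSkM At) :
    (interpFunctor a).map (inr A B) = inr ((interpFunctor a).obj A) ((interpFunctor a).obj B) :=
  Category.id_comp _

theorem isStrict_interpFunctor : IsStrictDistSkewMonoidal (interpFunctor a) where
  obj_unit := rfl
  obj_tensor _ _ := rfl
  map_tensor f g := (interpFunctor_map_tensorHom a f g).trans
    ((Category.id_comp _).trans (Category.comp_id _)).symm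
  map_leftUnitor A := (interpFunctor_map_leftUnitor a A).trans
    (Category.id_comp _).symm
  map_rightUnitor A := (interpFunctor_map_rightUnitor a A).trans
    (Category.comp_id _).symm
  map_associator A B C := (interpFunctor_map_associator a A B C).trans
    ((Category.id_comp _).trans (Category.comp_id _)).symm
  obj_prod _ _ := rfl
  map_fst A B := (interpFunctor_map_fst a A B).trans
    (Category.id_comp _).symm
  map_snd A B := (interpFunctor_map_snd a A B).trans
    (Category.id_comp _).symm
  obj_coprod _ _ := rfl
  map_inl A B := (interpFunctor_map_inl a A B).trans
    (Category.comp_id _).symm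
  map_inr A B := (interpFunctor_map_inr a A B).trans
    (Category.comp_id _).symm

end InterpFunctor

/-- The interpretation of the syntactic category in modules. -/
noncomputable abbrev toModules : FDSkM At ⥤ LeftModule At := interpFunctor atomModule

theorem toModules_injective {A B : FDSkM At} {f g : A ⟶ B}
    (h : toModules.map f = toModules.map g) : f = g := by
  revert h
  exact Quotient.inductionOn₂ f g fun f g h => mk_eq_mk (Deriv.eqv_of_interp_eq h)

/-- Pairing in the syntactic category. -/
def conjLift {A B C : FDSkM At} (f : C ⟶ A) (g : C ⟶ B) : C ⟶ (Fma.conj A B : FDSkM At) :=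
  Quotient.map₂ .conjR (fun _ _ k _ _ k' => .conjR k k') f g

theorem toModules_map_conjLift {A B C : FDSkM At} (f : C ⟶ A) (g : C ⟶ B) :
    toModules.map (conjLift f g) = pair (toModules.map f) (toModules.map g) :=
  Quotient.inductionOn₂ f g fun _ _ => rfl

theorem toModules_map_comp_fst {A B C : FDSkM At} (k : C ⟶ prod A B) :
    toModules.map (k ≫ fst A B) = toModules.map k ≫ fst (fmaModule A) (fmaModule B) :=
  (toModules.map_comp _ _).trans (congrArg (_ ≫ ·) (interpFunctor_map_fst _ A B))

theorem conjLift_fst {A B C : FDSkM At} (f : C ⟶ A) (g : C ⟶ B) :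
    conjLift f g ≫ fst A B = f :=
  toModules_injective <| (toModules_map_comp_fst _).trans <|
    (congrArg (· ≫ _) (toModules_map_conjLift f g)).trans (pair_fst _ _)

theorem toModules_map_comp_snd {A B C : FDSkM At} (k : C ⟶ prod A B) :
    toModules.map (k ≫ snd A B) = toModules.map k ≫ snd (fmaModule A) (fmaModule B) :=
  (toModules.map_comp _ _).trans (congrArg (_ ≫ ·) (interpFunctor_map_snd _ A B))

theorem conjLift_snd {A B C : FDSkM At} (f : C ⟶ A) (g : C ⟶ B) :
    conjLift f g ≫ snd A B = g :=
  toModules_injective <| (toModules_map_comp_snd _).trans <|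
    (congrArg (· ≫ _) (toModules_map_conjLift f g)).trans (pair_snd _ _)

/-- Copairing in the syntactic category. -/
def disjDesc {A B C : FDSkM At} (f : A ⟶ C) (g : B ⟶ C) : (Fma.disj A B : FDSkM At) ⟶ C :=
  Quotient.map₂ .disjL (fun _ _ k _ _ k' => .disjL k k') f g

theorem toModules_map_disjDesc {A B C : FDSkM At} (f : A ⟶ C) (g : B ⟶ C) :
    toModules.map (disjDesc f g) =
      caseHead fmaModule [] (toModules.map f) (toModules.map g) :=
  Quotient.inductionOn₂ f g fun _ _ => rfl

theorem isSum_inl_inr (A B : FDSkM At) : IsSum (inl A B) (inr A B) := fun Z f g => by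
  have hl (k : coprod A B ⟶ Z) : toModules.map (inl A B ≫ k) =
      inl (fmaModule A) (fmaModule B) ≫ toModules.map k :=
    (toModules.map_comp _ _).trans (congrArg (· ≫ _) (interpFunctor_map_inl _ A B))
  have hr (k : coprod A B ⟶ Z) : toModules.map (inr A B ≫ k) =
      inr (fmaModule A) (fmaModule B) ≫ toModules.map k :=
    (toModules.map_comp _ _).trans (congrArg (· ≫ _) (interpFunctor_map_inr _ A B))
  have h₁ : inl A B ≫ disjDesc f g = f := toModules_injective <|
    (hl _).trans ((congrArg (_ ≫ ·) (toModules_map_disjDesc f g)).trans (inl_caseHead (Γ := []) (toModules.map f) _))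
  have h₂ : inr A B ≫ disjDesc f g = g := toModules_injective <|
    (hr _).trans ((congrArg (_ ≫ ·) (toModules_map_disjDesc f g)).trans (inr_caseHead (Γ := []) (toModules.map f) _))
  refine ⟨disjDesc f g, ⟨h₁, h₂⟩, fun k hk => toModules_injective ?_⟩
  refine caseHead_ext (Γ := []) (o := fmaModule) ?_ ?_
  · exact (hl k).symm.trans ((congrArg toModules.map (hk.1.trans h₁.symm)).trans (hl _))
  · exact (hr k).symm.trans ((congrArg toModules.map (hk.2.trans h₂.symm)).trans (hr _))

/-- The inverse of the canonical map `(A ⊗ D) ∨ (B ⊗ D) ⟶ (A ∨ B) ⊗ D`. -/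
def distribInv (A B D : FDSkM At) :
    tensorObj (coprod A B) D ⟶ coprod (tensorObj A D) (tensorObj B D) :=
  Quotient.mk _ (.tensorL (.disjL (.disjR₁ (.tensorR (.ax A) (.pass (.ax D))))
    (.disjR₂ (.tensorR (.ax B) (.pass (.ax D))))))

theorem isSum_tensor (A B D : FDSkM At) :
    IsSum (tensorHom (inl A B) (𝟙 D)) (tensorHom (inr A B) (𝟙 D)) := fun Z f g => by
  have hl {Z : FDSkM At} (k : tensorObj (coprod A B) D ⟶ Z) :
      toModules.map (tensorHom (inl A B) (𝟙 D) ≫ k) =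
        ctxMap fmaModule (inl (fmaModule A) (fmaModule B)) [D] ≫ toModules.map k :=
    (toModules.map_comp _ _).trans (congrArg (· ≫ _) ((interpFunctor_map_tensorHom _ _ _).trans
      (congrArg (tensorHom · _) (interpFunctor_map_inl _ A B))))
  have hr {Z : FDSkM At} (k : tensorObj (coprod A B) D ⟶ Z) :
      toModules.map (tensorHom (inr A B) (𝟙 D) ≫ k) =
        ctxMap fmaModule (inr (fmaModule A) (fmaModule B)) [D] ≫ toModules.map k :=
    (toModules.map_comp _ _).trans (congrArg (· ≫ _) ((interpFunctor_map_tensorHom _ _ _).trans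
      (congrArg (tensorHom · _) (interpFunctor_map_inr _ A B))))
  have h (A : FDSkM At) : (Deriv.tensorR (.ax A) (.pass (.ax D))).interp atomModule = 𝟙 _ :=
    (Deriv.Eqv.ax_tensor A D).symm.interp_eq atomModule
  have h₁ : tensorHom (inl A B) (𝟙 D) ≫ distribInv A B D = inl _ _ :=
    toModules_injective <| (hl _).trans <| (inl_caseHead _ _).trans <|
      congrArg (· ≫ inl _ _) (h A)
  have h₂ : tensorHom (inr A B) (𝟙 D) ≫ distribInv A B D = inr _ _ :=
    toModules_injective <| (hr _).trans <| (inr_caseHead _ _).trans <|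
      congrArg (· ≫ inr _ _) (h B)
  obtain ⟨k, ⟨hk₁, hk₂⟩, -⟩ := isSum_inl_inr _ _ f g
  refine ⟨distribInv A B D ≫ k, ⟨?_, ?_⟩, fun m hm => toModules_injective ?_⟩
  · rw [← Category.assoc, h₁, hk₁]
  · rw [← Category.assoc, h₂, hk₂]
  · refine caseHead_ext (Γ := [D]) (o := fmaModule) ?_ ?_
    · refine (hl m).symm.trans (.trans (congrArg toModules.map ?_) (hl _))
      rw [hm.1, ← Category.assoc, h₁, hk₁]
    · refine (hr m).symm.trans (.trans (congrArg toModules.map ?_) (hr _))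
      rw [hm.2, ← Category.assoc, h₂, hk₂]

open DistSkewMonoidalCategory in
instance distSkewMonoidalCategory : DistSkewMonoidalCategory (FDSkM At) where
  tensorHom_id A B := toModules_injective <|
    (interpFunctor_map_tensorHom _ _ _).trans (tensorHom_id _ _)
  tensorHom_comp f f' g g' := toModules_injective <| by
    simp only [Functor.map_comp, interpFunctor_map_tensorHom]
    exact tensorHom_comp _ _ _ _
  leftUnitor_naturality f := toModules_injective <| by
    simp only [Functor.map_comp, interpFunctor_map_tensorHom, interpFunctor_map_leftUnitor]
    exact leftUnitor_naturality _
  rightUnitor_naturality f := toModules_injective <| by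
    simp only [Functor.map_comp, interpFunctor_map_tensorHom, interpFunctor_map_rightUnitor]
    exact rightUnitor_naturality _
  associator_naturality f g h := toModules_injective <| by
    simp only [Functor.map_comp, interpFunctor_map_tensorHom, interpFunctor_map_associator]
    exact associator_naturality _ _ _
  unit_unit := toModules_injective <| by
    simp only [Functor.map_comp, interpFunctor_map_leftUnitor, interpFunctor_map_rightUnitor]
    exact unit_unit
  triangle A B := toModules_injective <| by
    simp only [Functor.map_comp, interpFunctor_map_tensorHom, interpFunctor_map_leftUnitor,
      interpFunctor_map_rightUnitor, interpFunctor_map_associator]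
    exact triangle _ _
  associator_leftUnitor A B := toModules_injective <| by
    simp only [Functor.map_comp, interpFunctor_map_tensorHom, interpFunctor_map_leftUnitor,
      interpFunctor_map_associator]
    exact associator_leftUnitor _ _
  rightUnitor_associator A B := toModules_injective <| by
    simp only [Functor.map_comp, interpFunctor_map_tensorHom, interpFunctor_map_rightUnitor,
      interpFunctor_map_associator]
    exact rightUnitor_associator _ _
  pentagon A B D E := toModules_injective <| by
    simp only [Functor.map_comp, interpFunctor_map_tensorHom, interpFunctor_map_associator]
    exact pentagon _ _ _ _
  prod_isLimit A B := ⟨BinaryFan.IsLimit.mk _ (fun f g => conjLift f g)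
    (fun f g => conjLift_fst f g) (fun f g => conjLift_snd f g)
    (fun f g k h₁ h₂ => toModules_injective <| prod_hom_ext
      ((toModules_map_comp_fst k).symm.trans ((congrArg toModules.map
        (h₁.trans (conjLift_fst f g).symm)).trans (toModules_map_comp_fst _)))
      ((toModules_map_comp_snd k).symm.trans ((congrArg toModules.map
        (h₂.trans (conjLift_snd f g).symm)).trans (toModules_map_comp_snd _))))⟩
  coprod_isColimit A B := (isSum_inl_inr A B).nonempty_isColimit
  distrib A B D := (isSum_tensor A B D).isIso_desc _

end FDSkM

end SkewLogic

universe v₁ w₁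

namespace SkewLogic

open DistSkewMonoidalStruct DistSkewMonoidalCategory

section Over

variable {C : Type w} [Category.{v} C] {D : Type w₁} [Category.{v₁} D] (G : C ⥤ D)

/-- `f'` is the image of `f` under `G`, up to equality of objects. -/
inductive Over : {X Y : C} → (X ⟶ Y) → {X' Y' : D} → (X' ⟶ Y') → Prop
  | intro {X Y : C} (f : X ⟶ Y) : Over f (G.map f)

namespace Over

variable {G} {X Y Z : C} {X' Y' Z' : D}

theorem of_eq {f : X ⟶ Y} {f' : X' ⟶ Y'} (hX : G.obj X = X') (hY : G.obj Y = Y')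
    (h : G.map f = eqToHom hX ≫ f' ≫ eqToHom hY.symm) : Over G f f' := by
  subst hX hY
  simp only [eqToHom_refl, Category.id_comp, Category.comp_id] at h
  exact h ▸ .intro f

theorem heq {f : X ⟶ Y} {f' : X' ⟶ Y'} (h : Over G f f') : HEq (G.map f) f' := by
  cases h; rfl

theorem eq {f : X ⟶ Y} {f' f'' : X' ⟶ Y'} (h : Over G f f') (h' : Over G f f'') : f' = f'' :=
  eq_of_heq (h.heq.symm.trans h'.heq)

theorem exists_of_obj (f : X ⟶ Y) (hX : G.obj X = X') (hY : G.obj Y = Y') :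
    ∃ f' : X' ⟶ Y', Over G f f' := by
  subst hX hY
  exact ⟨_, .intro f⟩

theorem dom {f : X ⟶ Y} {f' : X' ⟶ Y'} (h : Over G f f') : G.obj X = X' := by
  cases h; rfl

theorem cod {f : X ⟶ Y} {f' : X' ⟶ Y'} (h : Over G f f') : G.obj Y = Y' := by
  cases h; rfl

theorem id (hX : G.obj X = X') : Over G (𝟙 X) (𝟙 X') := by
  subst hX
  exact of_eq rfl rfl (by simp)

theorem comp {f : X ⟶ Y} {f' : X' ⟶ Y'} {g : Y ⟶ Z} {g' : Y' ⟶ Z'} (h : Over G f f')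
    (k : Over G g g') : Over G (f ≫ g) (f' ≫ g') := by
  cases h
  cases k
  exact of_eq rfl rfl (by simp)

theorem of_heq {A B : C} {f : X ⟶ Y} {g : A ⟶ B} {f' : X' ⟶ Y'} (h : Over G f f') (hX : X = A)
    (hY : Y = B) (hg : HEq f g) : Over G g f' := by
  subst hX hY
  exact eq_of_heq hg ▸ h

end Over

namespace IsStrictDistSkewMonoidal

variable [DistSkewMonoidalStruct C] [DistSkewMonoidalStruct D] {G}
  (hG : IsStrictDistSkewMonoidal G)
include hG

theorem over_tensorHom {X Y Z W : C} {X' Y' Z' W' : D} {f : X ⟶ Y} {f' : X' ⟶ Y'} {g : Z ⟶ W}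
    {g' : Z' ⟶ W'} (h : Over G f f') (k : Over G g g') :
    Over G (tensorHom f g) (tensorHom f' g') := by
  cases h
  cases k
  exact .of_eq (hG.obj_tensor _ _) (hG.obj_tensor _ _) (hG.map_tensor f g)

theorem over_leftUnitor {X : C} {X' : D} (h : G.obj X = X') :
    Over G (leftUnitor X) (leftUnitor X') := by
  subst h
  exact .of_eq _ rfl (by simpa using hG.map_leftUnitor X)

theorem over_rightUnitor {X : C} {X' : D} (h : G.obj X = X') :
    Over G (rightUnitor X) (rightUnitor X') := by
  subst h
  exact .of_eq rfl (by rw [hG.obj_tensor, hG.obj_unit]) (by simpa using hG.map_rightUnitor X)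

theorem over_associator {X Y Z : C} {X' Y' Z' : D} (hX : G.obj X = X') (hY : G.obj Y = Y')
    (hZ : G.obj Z = Z') : Over G (associator X Y Z) (associator X' Y' Z') := by
  subst hX hY hZ
  exact .of_eq (by rw [hG.obj_tensor, hG.obj_tensor]) (by rw [hG.obj_tensor, hG.obj_tensor])
    (hG.map_associator X Y Z)

theorem over_fst {X Y : C} {X' Y' : D} (hX : G.obj X = X') (hY : G.obj Y = Y') :
    Over G (fst X Y) (fst X' Y') := by
  subst hX hY
  exact .of_eq _ rfl (by simpa using hG.map_fst X Y)

theorem over_snd {X Y : C} {X' Y' : D} (hX : G.obj X = X') (hY : G.obj Y = Y') :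
    Over G (snd X Y) (snd X' Y') := by
  subst hX hY
  exact .of_eq _ rfl (by simpa using hG.map_snd X Y)

theorem over_inl {X Y : C} {X' Y' : D} (hX : G.obj X = X') (hY : G.obj Y = Y') :
    Over G (inl X Y) (inl X' Y') := by
  subst hX hY
  exact .of_eq rfl (hG.obj_coprod X Y) (by simpa using hG.map_inl X Y)

theorem over_inr {X Y : C} {X' Y' : D} (hX : G.obj X = X') (hY : G.obj Y = Y') :
    Over G (inr X Y) (inr X' Y') := by
  subst hX hY
  exact .of_eq rfl (hG.obj_coprod X Y) (by simpa using hG.map_inr X Y)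

variable {Ob : Type u} {o : Ob → C} {o' : Ob → D} (ho : ∀ A, G.obj (o A) = o' A)
include ho

theorem obj_ctx {X : C} {X' : D} (hX : G.obj X = X') (Γ : List Ob) :
    G.obj (ctx o X Γ) = ctx o' X' Γ := by
  induction Γ generalizing X X' with
  | nil => exact hX
  | cons A Γ ih => exact ih (by rw [hG.obj_tensor, hX, ho])

theorem over_ctxMap {X Y : C} {X' Y' : D} {f : X ⟶ Y} {f' : X' ⟶ Y'} (h : Over G f f')
    (Γ : List Ob) : Over G (ctxMap o f Γ) (ctxMap o' f' Γ) := by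
  induction Γ generalizing X Y X' Y' with
  | nil => exact h
  | cons A Γ ih => exact ih (hG.over_tensorHom h (.id (ho A)))

theorem over_stoupCut {X Y Z : C} {X' Y' Z' : D} {Γ Δ : List Ob} {f : ctx o X Γ ⟶ Y}
    {f' : ctx o' X' Γ ⟶ Y'} {g : ctx o Y Δ ⟶ Z} {g' : ctx o' Y' Δ ⟶ Z'} (h : Over G f f')
    (k : Over G g g') : Over G (stoupCut o Γ f g) (stoupCut o' Γ f' g') := by
  induction Γ generalizing X X' with
  | nil => exact (hG.over_ctxMap ho h Δ).comp k
  | cons A Γ ih => exact ih h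

theorem over_assocCtx {X Y : C} {X' Y' : D} (hX : G.obj X = X') (hY : G.obj Y = Y')
    (Γ : List Ob) : Over G (assocCtx o X Y Γ) (assocCtx o' X' Y' Γ) := by
  induction Γ generalizing Y Y' with
  | nil => exact .id (by rw [hG.obj_tensor, hX, hY])
  | cons A Γ ih =>
    exact (hG.over_ctxMap ho (hG.over_associator hX hY (ho A)) Γ).comp
      (ih (by rw [hG.obj_tensor, hY, ho]))

theorem over_unitStrength {X B : C} {X' B' : D} {Γ : List Ob} (hX : G.obj X = X')
    {g : ctx o unit Γ ⟶ B} {g' : ctx o' unit Γ ⟶ B'} (h : Over G g g') :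
    Over G (unitStrength o X Γ g) (unitStrength o' X' Γ g') :=
  (hG.over_ctxMap ho (hG.over_rightUnitor hX) Γ).comp
    ((hG.over_assocCtx ho hX hG.obj_unit Γ).comp (hG.over_tensorHom (.id hX) h))

variable [DistSkewMonoidalCategory C] [DistSkewMonoidalCategory D]

omit ho in
theorem over_pair {X A B : C} {X' A' B' : D} {f : X ⟶ A} {f' : X' ⟶ A'} {g : X ⟶ B}
    {g' : X' ⟶ B'} (h : Over G f f') (k : Over G g g') : Over G (pair f g) (pair f' g') := by
  obtain ⟨p, hp⟩ := Over.exists_of_obj (pair f g) h.dom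
    (show _ = prod A' B' by rw [hG.obj_prod, h.cod, k.cod])
  suffices p = pair f' g' from this ▸ hp
  refine prod_hom_ext ?_ ?_
  · exact (hp.comp (hG.over_fst h.cod k.cod)).eq (by rw [pair_fst, pair_fst]; exact h)
  · exact (hp.comp (hG.over_snd h.cod k.cod)).eq (by rw [pair_snd, pair_snd]; exact k)

theorem over_caseHead {A B Z : C} {A' B' Z' : D} {Γ : List Ob} (hA : G.obj A = A')
    (hB : G.obj B = B') {f : ctx o A Γ ⟶ Z} {f' : ctx o' A' Γ ⟶ Z'} {g : ctx o B Γ ⟶ Z}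
    {g' : ctx o' B' Γ ⟶ Z'} (h : Over G f f') (k : Over G g g') :
    Over G (caseHead o Γ f g) (caseHead o' Γ f' g') := by
  obtain ⟨p, hp⟩ := Over.exists_of_obj (caseHead o Γ f g)
    (hG.obj_ctx ho (show _ = coprod A' B' by rw [hG.obj_coprod, hA, hB]) Γ) h.cod
  suffices p = caseHead o' Γ f' g' from this ▸ hp
  refine caseHead_ext ?_ ?_
  · refine ((hG.over_ctxMap ho (hG.over_inl hA hB) Γ).comp hp).eq ?_
    rw [inl_caseHead, inl_caseHead]
    exact h
  · refine ((hG.over_ctxMap ho (hG.over_inr hA hB) Γ).comp hp).eq ?_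
    rw [inr_caseHead, inr_caseHead]
    exact k

omit ho
variable {At : Type u} {a : At → C} {a' : At → D} (ha : ∀ X, G.obj (a X) = a' X)
include ha

omit [DistSkewMonoidalCategory C] [DistSkewMonoidalCategory D] in
theorem obj_interp (A : Fma At) : G.obj (A.interp a) = A.interp a' := by
  induction A with
  | atom X => exact ha X
  | unit => exact hG.obj_unit
  | tensor A B ihA ihB => exact (hG.obj_tensor _ _).trans (by rw [ihA, ihB])
  | conj A B ihA ihB => exact (hG.obj_prod _ _).trans (by rw [ihA, ihB])
  | disj A B ihA ihB => exact (hG.obj_coprod _ _).trans (by rw [ihA, ihB])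

theorem over_interp {S : Option (Fma At)} {Γ : List (Fma At)} {A : Fma At} (f : Deriv S Γ A) :
    Over G (f.interp a) (f.interp a') := by
  have ho := hG.obj_interp ha
  induction f with
  | ax A => exact .id (ho A)
  | pass f ih => exact (hG.over_ctxMap ho (hG.over_leftUnitor (ho _)) _).comp ih
  | unitL f ih => exact ih
  | unitR => exact .id hG.obj_unit
  | tensorL f ih => exact ih
  | tensorR f g ihf ihg => exact hG.over_stoupCut ho ihf (hG.over_unitStrength ho (ho _) ihg)
  | conjL₁ f ih => exact (hG.over_ctxMap ho (hG.over_fst (ho _) (ho _)) _).comp ih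
  | conjL₂ f ih => exact (hG.over_ctxMap ho (hG.over_snd (ho _) (ho _)) _).comp ih
  | conjR f g ihf ihg => exact hG.over_pair ihf ihg
  | disjL f g ihf ihg => exact hG.over_caseHead ho (ho _) (ho _) ihf ihg
  | disjR₁ f ih => exact ih.comp (hG.over_inl (ho _) (ho _))
  | disjR₂ f ih => exact ih.comp (hG.over_inr (ho _) (ho _))

end IsStrictDistSkewMonoidal

end Over

namespace FDSkM

variable {At : Type u}

theorem interp_atom (A : Fma At) : A.interp (C := FDSkM At) Fma.atom = A := by
  induction A with
  | atom X => rfl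
  | unit => rfl
  | tensor A B ihA ihB => exact congrArg₂ Fma.tensor ihA ihB
  | conj A B ihA ihB => exact congrArg₂ Fma.conj ihA ihB
  | disj A B ihA ihB => exact congrArg₂ Fma.disj ihA ihB

theorem heq_of_heq_toModules {A B A' B' : FDSkM At} {f : A ⟶ B} {g : A' ⟶ B'} (hA : A = A')
    (hB : B = B') (h : HEq (toModules.map f) (toModules.map g)) : HEq f g := by
  subst hA hB
  exact heq_of_eq (toModules_injective (eq_of_heq h))

theorem interp_atom_heq {A B : Fma At} (f : Deriv (some A) [] B) :
    HEq (f.interp (C := FDSkM At) Fma.atom) (Quotient.mk (Deriv.setoid (some A) [] B) f) :=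
  heq_of_heq_toModules (interp_atom A) (interp_atom B)
    ((isStrict_interpFunctor atomModule).over_interp (fun _ => rfl) f).heq

theorem eq_interpFunctor {D : Type w} [Category.{v} D] [DistSkewMonoidalStruct D]
    [DistSkewMonoidalCategory D] {a : At → D} {G : FDSkM At ⥤ D}
    (hG : IsStrictDistSkewMonoidal G) (ha : ∀ X, G.obj (Fma.atom X) = a X) :
    G = interpFunctor a := by
  refine Functor.hext (fun A => ?_) fun A B f => Quotient.inductionOn f fun f => ?_
  · exact (congrArg G.obj (interp_atom A)).symm.trans (hG.obj_interp ha A)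
  · exact ((hG.over_interp ha f).of_heq (interp_atom A) (interp_atom B) (interp_atom_heq f)).heq

end FDSkM

end SkewLogic

theorem mainTheorem2 (At : Type u) :
    ∃ L : SkewLogic.FDSkM.CategoryLaws At,
      letI : Category.{u} (SkewLogic.FDSkM At) := SkewLogic.FDSkM.category L
      letI : SkewLogic.DistSkewMonoidalStruct (SkewLogic.FDSkM At) := SkewLogic.FDSkM.struct L
      SkewLogic.DistSkewMonoidalCategory (SkewLogic.FDSkM At) ∧
      ∀ (D : Type w) [Category.{v} D] [SkewLogic.DistSkewMonoidalStruct D]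
        [SkewLogic.DistSkewMonoidalCategory D] (FAt : At → D),
        ∃! F : SkewLogic.FDSkM At ⥤ D,
          SkewLogic.IsStrictDistSkewMonoidal F ∧
            ∀ X : At, F.obj (SkewLogic.Fma.atom X) = FAt X :=
  ⟨SkewLogic.FDSkM.categoryLaws At, SkewLogic.FDSkM.distSkewMonoidalCategory,
    fun _ _ _ _ FAt => ⟨SkewLogic.FDSkM.interpFunctor FAt,
      ⟨SkewLogic.FDSkM.isStrict_interpFunctor FAt, fun _ => rfl⟩,
      fun _ hG => SkewLogic.FDSkM.eq_interpFunctor hG.1 hG.2⟩⟩
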